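/- Let $Q$ be a smooth $n$-manifold (Hausdorff, second countable) and $\mathcal D\to Q$ a smooth vector bundle of rank $m$ with a skew-symmetric algebroid structure: a smooth bundle map $\rho:\mathcal D\to TQ$ over the identity (the anchor) and a skew-symmetric $\mathbb R$-bilinear bracket $[\![\cdot,\cdot]\!]$ on $\Gamma(\mathcal D)$ with $[\![X,fY]\!]=f[\![X,Y]\!]+\rho(X)(f)\,Y$. Let a fully actuated nonholonomic mechanical control system on $\mathcal D$ be given: a smooth symmetric nondegenerate bundle metric $\mathcal G$ on $\mathcal D$, a potential $V\in C^\infty(Q)$ and input sections $Y_1,\dots,Y_m\in\Gamma(\mathcal D)$ that form a basis of every fibre. Let $\nabla$ be the Levi-Civita connection of $\mathcal G$, defined by the Koszul formula $$2\mathcal G(\nabla_XY,Z)=\rho(X)(\mathcal G(Y,Z))+\rho(Y)(\mathcal G(X,Z))-\rho(Z)(\mathcal G(X,Y))+\mathcal G(X,[\![Z,Y]\!])+\mathcal G(Y,[\![Z,X]\!])-\mathcal G(Z,[\![Y,X]\!]),$$ let $\mathcal G(\operatorname{grad}V,X)=\rho(X)(V)$, let $\mathcal G_{AB}=\mathcal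 G(Y_A,Y_B)$ with inverse matrix $(\mathcal G^{AB})$, and $\nabla_{Y_A}Y_B=\Gamma^C_{AB}Y_C$. Write $y^A$ for the fibre coordinates on $\mathcal D$ in the frame $\{Y_A\}$. Let $U\subseteq\mathbb R^m$ be open, $C:\mathcal D\times U\to\mathbb R$ a smooth cost and $T>0$. A $C^1$ curve $\gamma:[0,T]\to\mathcal D$ over $q:[0,T]\to Q$ is $\rho$-admissible if $\dot q=\rho(\gamma)$. A solution of the control problem is a pair $(\gamma,u)$ with $\gamma$ a $\rho$-admissible $C^1$ curve and $u:[0,T]\to U$ such that $\nabla_\gamma\gamma+\operatorname{grad}V(q)=u^AY_A(q)$. It is optimal if it minimizes $\mathcal J(\gamma,u)=\int_0^TC(\gamma,u)\,dt$ among all solutions with the same end points $\gamma(0),\gamma(T)\in\mathcal D$ whose graph $t\mapsto(t,\gamma(t),u(t))$ stays in some fixed neighbourhood of its own graph (weak local minimizer; in particular every global minimizer). Fix a chart $(q^i)$ of $Q$, consider only curves $\gamma$ whose base curve stays in its domain, write $\rho(Y_A)=\rho^i_A\,\partial/\partial q^i$, and let $$\mathcal L(q,y,\dot y)=C\Big(q,y,\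 \dot y^C+\Gamma^C_{AB}y^Ay^B+\mathcal G^{CB}\rho^i_B\frac{\partial V}{\partial q^i}\Big)$$ be the cost with the controls eliminated, in the coordinates $(q^i,y^A,\dot y^A)$ of $\mathcal D^{(2)}=\{\dot q^i=\rho^i_Ay^A\}\subset T\mathcal D$. For $\mu_0\in\{0,1\}$ and a continuous curve $\lambda:[0,T]\to\mathbb R^n$ call $(\gamma,\lambda)$ $\mu_0$-stationary if it is a stationary point of $$\int_0^T\big(\mu_0\mathcal L(q,y,\dot y)+\lambda_i(\dot q^i-\rho^i_A(q)y^A)\big)\,dt$$ for all $C^1$ variations of $(q,y)$ with fixed end points and all continuous variations of $\lambda$. Call $\gamma$ a normal extremal with multipliers $\lambda$ if $(\gamma,\lambda)$ is $1$-stationary, and an abnormal extremal with multipliers $\lambda$ if it is $0$-stationary and $\lambda\not\equiv0$. Then: 1. Let $\gamma=(q,y)$ be a $C^1$ curve whose eliminated control $\dot y^C+\Gamma^C_{AB}y^Ay^B+\mathcal G^{CB}\rho^i_B\,\partial V/\partial q^i$ takes values in $U$, and let $\lambda:[0,T]\to\mathbb R^n$. Then $\gamma$ is a normal extremal with multipliers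 $\lambda$ if and only if $\gamma$ is $\rho$-admissible and, on $[0,T]$ (the left-hand sides being differentiable), $$\dot\lambda_i=\frac{\partial\mathcal L}{\partial q^i}-\lambda_j\frac{\partial\rho^j_A}{\partial q^i}y^A,\qquad \frac{d}{dt}\Big(\frac{\partial\mathcal L}{\partial\dot y^A}\Big)=\frac{\partial\mathcal L}{\partial y^A}-\rho^i_A\lambda_i,\qquad \dot q^i=\rho^i_Ay^A.$$ 2. If $(\gamma,u)$ is optimal, then $\gamma$ is a normal or an abnormal extremal. In particular, if $\gamma$ is not an abnormal extremal, there are multipliers $\lambda_i$ such that the equations of 1 hold. -/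

import Mathlib

open Bundle Set MeasureTheory
open scoped Manifold ContDiff Topology

noncomputable section

namespace NonholonomicControl

/-- A skew-symmetric algebroid structure on a rank `m` real smooth vector bundle `D` over an
`n`-dimensional manifold `Q`: a smooth fibrewise linear anchor `ρ : D → TQ` over the identity and a
skew-symmetric `ℝ`-bilinear bracket of smooth sections that satisfies the Leibniz rule
`⟦X, f Y⟧ = f ⟦X, Y⟧ + ρ(X)(f) Y`. The Jacobi identity is not required. -/
structure SkewAlgebroid (n m : ℕ) (Q : Type*) [TopologicalSpace Q]
    [ChartedSpace (EuclideanSpace ℝ (Fin n)) Q] [IsManifold (𝓡 n) ∞ Q]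
    (D : Q → Type*) [TopologicalSpace (TotalSpace (EuclideanSpace ℝ (Fin m)) D)]
    [∀ x, AddCommGroup (D x)] [∀ x, Module ℝ (D x)] [∀ x, TopologicalSpace (D x)]
    [FiberBundle (EuclideanSpace ℝ (Fin m)) D] [VectorBundle ℝ (EuclideanSpace ℝ (Fin m)) D]
    [ContMDiffVectorBundle ∞ (EuclideanSpace ℝ (Fin m)) D (𝓡 n)] where
  /-- the anchor map -/
  anchor : ∀ x : Q, D x →ₗ[ℝ] TangentSpace (𝓡 n) x
  anchor_smooth : ContMDiff ((𝓡 n).prod 𝓘(ℝ, EuclideanSpace ℝ (Fin m))) (𝓡 n).tangent ∞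
    (fun v : TotalSpace (EuclideanSpace ℝ (Fin m)) D =>
      (⟨v.proj, anchor v.proj v.snd⟩ : TangentBundle (𝓡 n) Q))
  /-- the bracket of smooth sections -/
  bracket : Cₛ^∞⟮𝓡 n; EuclideanSpace ℝ (Fin m), D⟯ →ₗ[ℝ]
    Cₛ^∞⟮𝓡 n; EuclideanSpace ℝ (Fin m), D⟯ →ₗ[ℝ] Cₛ^∞⟮𝓡 n; EuclideanSpace ℝ (Fin m), D⟯
  bracket_skew : ∀ X Y, bracket X Y = -bracket Y X
  leibniz : ∀ (f : C^∞⟮𝓡 n, Q; ℝ⟯) (X Y fY : Cₛ^∞⟮𝓡 n; EuclideanSpace ℝ (Fin m), D⟯),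
    (∀ x, fY x = f x • Y x) →
      ∀ x, bracket X fY x =
        f x • bracket X Y x + (show ℝ from mfderiv (𝓡 n) 𝓘(ℝ, ℝ) f x (anchor x (X x))) • Y x

/-- A fully actuated nonholonomic mechanical control system on a skew-symmetric algebroid:
a nondegenerate bundle metric `𝒢` on `D`, a potential `V`, and `m = rank D` input sections
`Y₁, …, Yₘ` that span `D`. -/
structure System (n m : ℕ) (Q : Type*) [TopologicalSpace Q]
    [ChartedSpace (EuclideanSpace ℝ (Fin n)) Q] [IsManifold (𝓡 n) ∞ Q]
    (D : Q → Type*) [TopologicalSpace (TotalSpace (EuclideanSpace ℝ (Fin m)) D)]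
    [∀ x, AddCommGroup (D x)] [∀ x, Module ℝ (D x)] [∀ x, TopologicalSpace (D x)]
    [FiberBundle (EuclideanSpace ℝ (Fin m)) D] [VectorBundle ℝ (EuclideanSpace ℝ (Fin m)) D]
    [ContMDiffVectorBundle ∞ (EuclideanSpace ℝ (Fin m)) D (𝓡 n)]
    extends SkewAlgebroid n m Q D where
  /-- the bundle metric on `D` -/
  metric : ∀ x : Q, D x →ₗ[ℝ] D x →ₗ[ℝ] ℝ
  metric_symm : ∀ x v w, metric x v w = metric x w v
  metric_nondegenerate : ∀ x v, (∀ w, metric x v w = 0) → v = 0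
  metric_smooth : ∀ X Y : Cₛ^∞⟮𝓡 n; EuclideanSpace ℝ (Fin m), D⟯,
    ContMDiff (𝓡 n) 𝓘(ℝ, ℝ) ∞ (fun x => metric x (X x) (Y x))
  /-- the potential energy -/
  V : C^∞⟮𝓡 n, Q; ℝ⟯
  /-- the input sections -/
  input : Fin m → Cₛ^∞⟮𝓡 n; EuclideanSpace ℝ (Fin m), D⟯
  input_linearIndependent : ∀ x, LinearIndependent ℝ (fun A => input A x)
  input_span : ∀ x, ⊤ ≤ Submodule.span ℝ (range fun A => input A x)

variable {n m : ℕ} {Q : Type*} [TopologicalSpace Q]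
    [ChartedSpace (EuclideanSpace ℝ (Fin n)) Q] [IsManifold (𝓡 n) ∞ Q]
    {D : Q → Type*} [TopologicalSpace (TotalSpace (EuclideanSpace ℝ (Fin m)) D)]
    [∀ x, AddCommGroup (D x)] [∀ x, Module ℝ (D x)] [∀ x, TopologicalSpace (D x)]
    [FiberBundle (EuclideanSpace ℝ (Fin m)) D] [VectorBundle ℝ (EuclideanSpace ℝ (Fin m)) D]
    [ContMDiffVectorBundle ∞ (EuclideanSpace ℝ (Fin m)) D (𝓡 n)]

namespace System

variable (S : System n m Q D)

/-- The basis `Y₁(x), …, Yₘ(x)` of the fibre `D x`. -/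
def frame (x : Q) : Module.Basis (Fin m) ℝ (D x) :=
  Module.Basis.mk (S.input_linearIndependent x) (S.input_span x)

/-- The fibre coordinates `y^A` of a point of `D` in the frame of the input sections. -/
def coord (v : TotalSpace (EuclideanSpace ℝ (Fin m)) D) : Fin m → ℝ :=
  fun A => (S.frame v.proj).repr v.snd A

/-- The point of `D` over `x` with fibre coordinates `y`, that is `y^A Y_A(x)`. -/
def point (x : Q) (y : Fin m → ℝ) : TotalSpace (EuclideanSpace ℝ (Fin m)) D :=
  ⟨x, ∑ A, y A • S.input A x⟩

/-- `ρ(X)(f)` for a section `X` and a function `f`. -/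
def lieDeriv (X : Cₛ^∞⟮𝓡 n; EuclideanSpace ℝ (Fin m), D⟯) (f : Q → ℝ) (x : Q) : ℝ :=
  mfderiv (𝓡 n) 𝓘(ℝ, ℝ) f x (S.anchor x (X x))

/-- The Gram matrix `𝒢_AB = 𝒢(Y_A, Y_B)`. -/
def gram (x : Q) : Matrix (Fin m) (Fin m) ℝ :=
  fun A B => S.metric x (S.input A x) (S.input B x)

/-- The right-hand side of the Koszul formula for `2 𝒢(∇_X Y, Z)`. -/
def koszul (X Y Z : Cₛ^∞⟮𝓡 n; EuclideanSpace ℝ (Fin m), D⟯) (x : Q) : ℝ :=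
  S.lieDeriv X (fun p => S.metric p (Y p) (Z p)) x
    + S.lieDeriv Y (fun p => S.metric p (X p) (Z p)) x
    - S.lieDeriv Z (fun p => S.metric p (X p) (Y p)) x
    + S.metric x (X x) (S.bracket Z Y x)
    + S.metric x (Y x) (S.bracket Z X x)
    - S.metric x (Z x) (S.bracket Y X x)

/-- The Levi-Civita connection of `𝒢`: the value of `∇_X Y` at `x`, obtained by solving the Koszul
formula in the frame of the input sections. -/
def leviCivita (X Y : Cₛ^∞⟮𝓡 n; EuclideanSpace ℝ (Fin m), D⟯) (x : Q) : D x :=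
  ∑ C, ((1 / 2 : ℝ) * ∑ B, (S.gram x)⁻¹ C B * S.koszul X Y (S.input B) x) • S.input C x

/-- The Christoffel symbols, `∇_{Y_A} Y_B = Γ^C_AB Y_C`. -/
def christoffel (A B C : Fin m) (x : Q) : ℝ :=
  (S.frame x).repr (S.leviCivita (S.input A) (S.input B) x) C

/-- The gradient section of the potential, `(grad V)^C = 𝒢^{CB} ρ(Y_B)(V)`. -/
def gradV (x : Q) : D x :=
  ∑ C, (∑ B, (S.gram x)⁻¹ C B * S.lieDeriv (S.input B) S.V x) • S.input C x

theorem gram_isUnit (x : Q) : IsUnit (S.gram x).det := by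
  rw [isUnit_iff_ne_zero]
  intro h
  obtain ⟨v, hv, hv0⟩ := Matrix.exists_vecMul_eq_zero_iff.2 h
  apply hv
  have hz : ∑ A, v A • S.input A x = 0 := by
    apply S.metric_nondegenerate x
    intro w
    have hlin : S.metric x (∑ A, v A • S.input A x) = 0 := by
      apply (S.frame x).ext
      intro B
      have := congrFun hv0 B
      simpa [frame, Matrix.vecMul, dotProduct, gram] using this
    rw [hlin]; rfl
  exact funext (Fintype.linearIndependent_iff.1 (S.input_linearIndependent x) v hz)

theorem metric_leviCivita (X Y : Cₛ^∞⟮𝓡 n; EuclideanSpace ℝ (Fin m), D⟯) (B : Fin m) (x : Q) :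
    2 * S.metric x (S.leviCivita X Y x) (S.input B x) = S.koszul X Y (S.input B) x := by
  have hg : ∀ i, ∑ C, S.gram x B C * (S.gram x)⁻¹ C i = if B = i then 1 else 0 := by
    intro i
    have := congrFun (congrFun (Matrix.mul_nonsing_inv _ (S.gram_isUnit x)) B) i
    simpa [Matrix.mul_apply, Matrix.one_apply] using this
  rw [S.metric_symm]
  simp only [leviCivita, map_sum, map_smul, smul_eq_mul]
  calc _ = ∑ i, (∑ C, S.gram x B C * (S.gram x)⁻¹ C i) * S.koszul X Y (S.input i) x := by
        simp only [Finset.mul_sum, Finset.sum_mul, gram]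
        rw [Finset.sum_comm]
        refine Finset.sum_congr rfl fun _ _ => Finset.sum_congr rfl fun _ _ => ?_
        ring
    _ = _ := by simp [hg]

theorem metric_gradV (B : Fin m) (x : Q) :
    S.metric x (S.gradV x) (S.input B x) = S.lieDeriv (S.input B) S.V x := by
  have hg : ∀ i, ∑ C, S.gram x B C * (S.gram x)⁻¹ C i = if B = i then 1 else 0 := by
    intro i
    have := congrFun (congrFun (Matrix.mul_nonsing_inv _ (S.gram_isUnit x)) B) i
    simpa [Matrix.mul_apply, Matrix.one_apply] using this
  rw [S.metric_symm]
  simp only [gradV, map_sum, map_smul, smul_eq_mul]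
  calc _ = ∑ i, (∑ C, S.gram x B C * (S.gram x)⁻¹ C i) * S.lieDeriv (S.input i) S.V x := by
        simp only [Finset.sum_mul, gram]
        rw [Finset.sum_comm]
        refine Finset.sum_congr rfl fun _ _ => Finset.sum_congr rfl fun _ _ => ?_
        ring
    _ = _ := by simp [hg]

/-- Derivative of the fibre coordinates along a curve in `D` on `[0, T]`. -/
def ydot (T : ℝ) (γ : ℝ → TotalSpace (EuclideanSpace ℝ (Fin m)) D) (t : ℝ) : Fin m → ℝ :=
  derivWithin (fun s => S.coord (γ s)) (Icc 0 T) t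

/-- The covariant derivative `∇_γ γ` of a curve in `D` along itself:
`ẏ^A Y_A + y^A y^B ∇_{Y_A} Y_B`. -/
def accel (T : ℝ) (γ : ℝ → TotalSpace (EuclideanSpace ℝ (Fin m)) D) (t : ℝ) : D (γ t).proj :=
  ∑ A, S.ydot T γ t A • S.input A (γ t).proj
    + ∑ A, ∑ B, (S.coord (γ t) A * S.coord (γ t) B) •
        S.leviCivita (S.input A) (S.input B) (γ t).proj

/-- `γ` is a `C¹` curve in `D` on `[0, T]`. -/
def IsC1 (T : ℝ) (γ : ℝ → TotalSpace (EuclideanSpace ℝ (Fin m)) D) : Prop :=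
  ContMDiffOn 𝓘(ℝ, ℝ) ((𝓡 n).prod 𝓘(ℝ, EuclideanSpace ℝ (Fin m))) 1 γ (Icc 0 T)

/-- `γ` is `ρ`-admissible on `[0, T]`: the velocity of its base curve is `ρ(γ(t))`. -/
def IsAdmissible (T : ℝ) (γ : ℝ → TotalSpace (EuclideanSpace ℝ (Fin m)) D) : Prop :=
  ∀ t ∈ Icc 0 T, HasMFDerivWithinAt 𝓘(ℝ, ℝ) (𝓡 n) (fun s => (γ s).proj) (Icc 0 T) t
    ((1 : ℝ →L[ℝ] ℝ).smulRight (S.anchor (γ t).proj (γ t).snd))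

/-- `(γ, u)` is a solution on `[0, T]` of the fully actuated nonholonomic control problem with
control set `U`: `γ` is a `ρ`-admissible `C¹` curve, `u` takes values in `U` and
`∇_γ γ + grad V = u^A Y_A`. -/
structure IsSolution (U : Set (Fin m → ℝ)) (T : ℝ)
    (γ : ℝ → TotalSpace (EuclideanSpace ℝ (Fin m)) D) (u : ℝ → Fin m → ℝ) : Prop where
  isC1 : IsC1 (n := n) T γ
  admissible : S.IsAdmissible T γ
  control_mem : ∀ t ∈ Icc 0 T, u t ∈ U
  motion : ∀ t ∈ Icc 0 T,
    S.accel T γ t + S.gradV (γ t).proj = ∑ A, u t A • S.input A (γ t).proj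

/-- The cost functional `𝒥(γ, u) = ∫₀ᵀ C(γ(t), u(t)) dt`. -/
def cost (C : TotalSpace (EuclideanSpace ℝ (Fin m)) D × (Fin m → ℝ) → ℝ) (T : ℝ)
    (γ : ℝ → TotalSpace (EuclideanSpace ℝ (Fin m)) D) (u : ℝ → Fin m → ℝ) : ℝ :=
  ∫ t in (0 : ℝ)..T, C (γ t, u t)

/-- `(γ, u)` is a (weak local) solution of the optimal control problem: it minimizes the cost among
all solutions of the control problem with the same boundary conditions in `D` whose graph
`t ↦ (t, γ'(t), u'(t))` stays in some open neighbourhood `W` of the graph of `(γ, u)`. A global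
minimizer is the case `W = univ`. -/
def IsOptimal (U : Set (Fin m → ℝ))
    (C : TotalSpace (EuclideanSpace ℝ (Fin m)) D × (Fin m → ℝ) → ℝ) (T : ℝ)
    (γ : ℝ → TotalSpace (EuclideanSpace ℝ (Fin m)) D) (u : ℝ → Fin m → ℝ) : Prop :=
  S.IsSolution U T γ u ∧
    ∃ W : Set (ℝ × TotalSpace (EuclideanSpace ℝ (Fin m)) D × (Fin m → ℝ)), IsOpen W ∧
      (∀ t ∈ Icc 0 T, (t, γ t, u t) ∈ W) ∧
      ∀ (γ' : ℝ → TotalSpace (EuclideanSpace ℝ (Fin m)) D) (u' : ℝ → Fin m → ℝ),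
        S.IsSolution U T γ' u' → γ' 0 = γ 0 → γ' T = γ T →
        (∀ t ∈ Icc 0 T, (t, γ' t, u' t) ∈ W) →
        cost C T γ u ≤ cost C T γ' u'

/-- The control expressed through `(q, y, ẏ)`:
`u^C = ẏ^C + Γ^C_AB y^A y^B + 𝒢^{CB} ρ_B^i ∂V/∂q^i`. -/
def elimControl (x : Q) (y v : Fin m → ℝ) : Fin m → ℝ :=
  fun C => v C + ∑ A, ∑ B, S.christoffel A B C x * y A * y B + (S.frame x).repr (S.gradV x) C

section Coordinates

variable (φ : OpenPartialHomeomorph Q (EuclideanSpace ℝ (Fin n)))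

/-- The components `ρ_A^i` of `ρ(Y_A)` in the coordinates `φ`. -/
def anchorCoeff (A : Fin m) (i : Fin n) (x : EuclideanSpace ℝ (Fin n)) : ℝ :=
  (show EuclideanSpace ℝ (Fin n) from
    mfderiv (𝓡 n) 𝓘(ℝ, EuclideanSpace ℝ (Fin n)) φ (φ.symm x)
      (S.anchor (φ.symm x) (S.input A (φ.symm x)))) i

/-- The Lagrangian `ℒ(q, y, ẏ)` on `D^(2)`, in the coordinates `(q^i, y^A, ẏ^A)`: the cost with the
controls eliminated. -/
def lagrangian (C : TotalSpace (EuclideanSpace ℝ (Fin m)) D × (Fin m → ℝ) → ℝ)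
    (x : EuclideanSpace ℝ (Fin n)) (y v : Fin m → ℝ) : ℝ :=
  C (S.point (φ.symm x) y, S.elimControl (φ.symm x) y v)

/-- The extended Lagrangian `μ₀ ℒ(q, y, ẏ) + λ_i (q̇^i - ρ_A^i(q) y^A)`; the normal case is
`μ₀ = 1`. -/
def extLagrangian (C : TotalSpace (EuclideanSpace ℝ (Fin m)) D × (Fin m → ℝ) → ℝ) (μ₀ : ℝ)
    (x : EuclideanSpace ℝ (Fin n)) (y : Fin m → ℝ) (w : EuclideanSpace ℝ (Fin n)) (v : Fin m → ℝ)
    (lam : Fin n → ℝ) : ℝ :=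
  μ₀ * S.lagrangian φ C x y v + ∑ i, lam i * (w i - ∑ A, S.anchorCoeff φ A i x * y A)

/-- The action of the extended Lagrangian along curves `x`, `y`, `lam` on `[0, T]`. -/
def extAction (C : TotalSpace (EuclideanSpace ℝ (Fin m)) D × (Fin m → ℝ) → ℝ) (μ₀ T : ℝ)
    (x : ℝ → EuclideanSpace ℝ (Fin n)) (y : ℝ → Fin m → ℝ) (lam : ℝ → Fin n → ℝ) : ℝ :=
  ∫ t in (0 : ℝ)..T, S.extLagrangian φ C μ₀ (x t) (y t)
    (derivWithin x (Icc 0 T) t) (derivWithin y (Icc 0 T) t) (lam t)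

/-- The coordinates `q^i(t)` of the base curve of `γ`. -/
def basePath (γ : ℝ → TotalSpace (EuclideanSpace ℝ (Fin m)) D) (t : ℝ) :
    EuclideanSpace ℝ (Fin n) :=
  φ (γ t).proj

/-- `lam` is a continuous multiplier curve such that `(γ, lam)` is a stationary point of the action
of the extended Lagrangian, for all variations of `(q, y)` with fixed end points and all variations
of the multipliers. -/
def IsExtremal (C : TotalSpace (EuclideanSpace ℝ (Fin m)) D × (Fin m → ℝ) → ℝ) (μ₀ T : ℝ)
    (γ : ℝ → TotalSpace (EuclideanSpace ℝ (Fin m)) D) (lam : ℝ → Fin n → ℝ) : Prop :=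
  ContinuousOn lam (Icc 0 T) ∧
    ∀ (δx : ℝ → EuclideanSpace ℝ (Fin n)) (δy : ℝ → Fin m → ℝ) (δlam : ℝ → Fin n → ℝ),
      ContDiff ℝ 1 δx → ContDiff ℝ 1 δy → Continuous δlam →
      δx 0 = 0 → δx T = 0 → δy 0 = 0 → δy T = 0 →
      HasDerivAt (fun ε : ℝ => S.extAction φ C μ₀ T
        (fun t => basePath φ γ t + ε • δx t) (fun t => S.coord (γ t) + ε • δy t)
        (fun t => lam t + ε • δlam t)) 0 0

/-- `γ` is a normal extremal with multipliers `lam`. -/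
def IsNormalExtremal (C : TotalSpace (EuclideanSpace ℝ (Fin m)) D × (Fin m → ℝ) → ℝ) (T : ℝ)
    (γ : ℝ → TotalSpace (EuclideanSpace ℝ (Fin m)) D) (lam : ℝ → Fin n → ℝ) : Prop :=
  S.IsExtremal φ C 1 T γ lam

/-- `γ` is an abnormal extremal with multipliers `lam`: these do not vanish identically, and the
cost does not enter the extended Lagrangian. -/
def IsAbnormalExtremal (C : TotalSpace (EuclideanSpace ℝ (Fin m)) D × (Fin m → ℝ) → ℝ) (T : ℝ)
    (γ : ℝ → TotalSpace (EuclideanSpace ℝ (Fin m)) D) (lam : ℝ → Fin n → ℝ) : Prop :=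
  S.IsExtremal φ C 0 T γ lam ∧ ∃ t ∈ Icc 0 T, lam t ≠ 0

/-- The necessary conditions, in the coordinates `(q^i, y^A)`:
`λ̇_i = ∂ℒ/∂q^i - λ_j (∂ρ_A^j/∂q^i) y^A`, `d/dt (∂ℒ/∂ẏ^A) = ∂ℒ/∂y^A - ρ_A^i λ_i` and
`q̇^i = ρ_A^i y^A` on `[0, T]`, including differentiability of the left-hand sides. -/
structure NecessaryConditions (C : TotalSpace (EuclideanSpace ℝ (Fin m)) D × (Fin m → ℝ) → ℝ)
    (T : ℝ) (γ : ℝ → TotalSpace (EuclideanSpace ℝ (Fin m)) D) (lam : ℝ → Fin n → ℝ) : Prop where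
  multiplier_eq : ∀ t ∈ Icc 0 T, ∀ i : Fin n,
    HasDerivWithinAt (fun s => lam s i)
      (fderiv ℝ (fun x => S.lagrangian φ C x (S.coord (γ t)) (S.ydot T γ t)) (basePath φ γ t)
          (EuclideanSpace.single i 1)
        - ∑ j, ∑ A, lam t j *
            fderiv ℝ (S.anchorCoeff φ A j) (basePath φ γ t) (EuclideanSpace.single i 1)
            * S.coord (γ t) A) (Icc 0 T) t
  fibre_eq : ∀ t ∈ Icc 0 T, ∀ A : Fin m,
    HasDerivWithinAt
      (fun s => fderiv ℝ (fun v => S.lagrangian φ C (basePath φ γ s) (S.coord (γ s)) v)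
        (S.ydot T γ s) (Pi.single A 1))
      (fderiv ℝ (fun y => S.lagrangian φ C (basePath φ γ t) y (S.ydot T γ t)) (S.coord (γ t))
          (Pi.single A 1)
        - ∑ i, S.anchorCoeff φ A i (basePath φ γ t) * lam t i) (Icc 0 T) t
  admissible_eq : ∀ t ∈ Icc 0 T, ∀ i : Fin n,
    HasDerivWithinAt (fun s => basePath φ γ s i)
      (∑ A, S.anchorCoeff φ A i (basePath φ γ t) * S.coord (γ t) A) (Icc 0 T) t

end Coordinates

end System

end NonholonomicControl

end

/-!
Full actuation makes the controls redundant: a `ρ`-admissible curve determines the control that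
drives it, so the cost becomes `∫ ℒ(q, y, ẏ) dt` and the only remaining constraint is
`q̇ = ρ(q) y`, with `ẏ` free.

Take the velocities `(q̇, ẏ) ∈ C([0, T])` as unknowns and recover `(q, y)` by integration from the
initial point. The cost, the constraint `q̇ - ρ(q) y` and the displacement of the end points are
then strictly differentiable, and the Lagrange multiplier rule yields a linear functional on the
target of the constraint that need not be continuous. The linearized constraint is a Volterra
equation for `δq̇`, solvable for every right-hand side; testing the functional against its solutions
shows that on `C([0, T])` it is integration against the solution `λ` of an adjoint linear equation.
In the abnormal case `λ = 0` would force the multipliers of the end points to vanish as well.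

Stationarity is turned into pointwise equations by the lemma of du Bois-Reymond.
-/

namespace NonholonomicControl

noncomputable section

section Superposition

variable {K E F : Type*} [NormedAddCommGroup E] [NormedAddCommGroup F]

/-- The superposition operator `u ↦ f ∘ u` on continuous maps. Where `f ∘ u` is not continuous it
takes the value `0`, so that it is defined on all of `C(K, E)` for a function `f` that is only
continuous on an open set. -/
def superpose [TopologicalSpace K] (f : E → F) (u : C(K, E)) : C(K, F) :=
  ContinuousMap.mkD (f ∘ u) 0

theorem superpose_apply [TopologicalSpace K] {f : E → F} {u : C(K, E)} {Ω : Set E}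
    (hf : ContinuousOn f Ω) (hu : ∀ t, u t ∈ Ω) (t : K) : superpose f u t = f (u t) :=
  ContinuousMap.mkD_apply_of_continuous (hf.comp_continuous u.continuous hu)

variable [NormedSpace ℝ E] [NormedSpace ℝ F]

theorem exists_forall_ball_norm_sub_fderiv_le {f : E → F} {Ω S : Set E} (hΩ : IsOpen Ω)
    (hf : ContDiffOn ℝ 1 f Ω) (hS : IsCompact S) (hSΩ : S ⊆ Ω) {c : ℝ} (hc : 0 < c) :
    ∃ δ > 0, ∀ x ∈ S, Metric.ball x δ ⊆ Ω ∧ ∀ y ∈ Metric.ball x δ, ∀ z ∈ Metric.ball x δ,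
      ‖f y - f z - fderiv ℝ f x (y - z)‖ ≤ c * ‖y - z‖ := by
  obtain ⟨δ₁, hδ₁, hball⟩ := hS.exists_thickening_subset_open hΩ hSΩ
  have hcont : ∀ x ∈ S, ContinuousAt (fderiv ℝ f) x := fun x hx =>
    (hf.continuousOn_fderiv_of_isOpen hΩ le_rfl).continuousAt (hΩ.mem_nhds (hSΩ hx))
  obtain ⟨δ₂, hδ₂, hclose⟩ := Metric.mem_uniformity_dist.1
    (hS.uniformContinuousAt_of_continuousAt _ hcont (Metric.dist_mem_uniformity hc))
  have hsub : ∀ x ∈ S, Metric.ball x (min δ₁ δ₂) ⊆ Ω := fun x hx y hy =>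
    hball (Metric.mem_thickening_iff.2 ⟨x, hx, hy.trans_le (min_le_left _ _)⟩)
  refine ⟨min δ₁ δ₂, lt_min hδ₁ hδ₂, fun x hx => ⟨hsub x hx, fun y hy z hz => ?_⟩⟩
  refine (convex_ball x (min δ₁ δ₂)).norm_image_sub_le_of_norm_fderiv_le'
    (fun w hw => (hf.differentiableOn one_ne_zero).differentiableAt
      (hΩ.mem_nhds (hsub x hx hw))) (fun w hw => ?_) hz hy
  have hw₂ : dist x w < δ₂ := (dist_comm x w).trans_lt (hw.trans_le (min_le_right _ _))
  rw [← dist_eq_norm, dist_comm]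
  exact (hclose hw₂ hx).le

variable [TopologicalSpace K] [CompactSpace K]

/-- Pointwise application of a continuous family of continuous linear maps: the form taken by the
derivative of a superposition operator. -/
def pointwiseApply (A : C(K, E →L[ℝ] F)) : C(K, E) →L[ℝ] C(K, F) :=
  LinearMap.mkContinuous
    { toFun := fun u => ⟨fun t => A t (u t), A.continuous.clm_apply u.continuous⟩
      map_add' := fun u v => by ext t; simp
      map_smul' := fun c u => by ext t; simp } ‖A‖ fun u =>
    (ContinuousMap.norm_le _ (by positivity)).2 fun t =>
      (A t).le_of_opNorm_le_of_le (A.norm_coe_le_norm t) (u.norm_coe_le_norm t)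

@[simp]
theorem pointwiseApply_apply (A : C(K, E →L[ℝ] F)) (u : C(K, E)) (t : K) :
    pointwiseApply A u t = A t (u t) := rfl

theorem hasStrictFDerivAt_superpose {f : E → F} {Ω : Set E} (hΩ : IsOpen Ω)
    (hf : ContDiffOn ℝ 1 f Ω) {u : C(K, E)} (hu : ∀ t, u t ∈ Ω) {A : C(K, E →L[ℝ] F)}
    (hA : ∀ t, A t = fderiv ℝ f (u t)) :
    HasStrictFDerivAt (superpose f) (pointwiseApply A) u := by
  refine .of_isLittleO (Asymptotics.isLittleO_iff.2 fun c hc => ?_)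
  obtain ⟨δ, hδ, h⟩ := exists_forall_ball_norm_sub_fderiv_le hΩ hf
    (isCompact_range u.continuous) (range_subset_iff.2 hu) hc
  rw [nhds_prod_eq]
  filter_upwards [Filter.prod_mem_prod (Metric.ball_mem_nhds u hδ) (Metric.ball_mem_nhds u hδ)]
  rintro ⟨v, w⟩ ⟨hv, hw⟩
  have hball : ∀ z ∈ Metric.ball u δ, ∀ t, z t ∈ Metric.ball (u t) δ := fun z hz t =>
    (ContinuousMap.dist_apply_le_dist t).trans_lt hz
  refine (ContinuousMap.norm_le _ (by positivity)).2 fun t => ?_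
  have hle := (h (u t) (mem_range_self t)).2
  have happly : ∀ z ∈ Metric.ball u δ, superpose f z t = f (z t) := fun z hz =>
    superpose_apply hf.continuousOn (fun s => (h (u s) (mem_range_self s)).1 (hball z hz s)) t
  simp only [ContinuousMap.sub_apply, pointwiseApply_apply, happly v hv, happly w hw, hA]
  exact (hle _ (hball v hv t) _ (hball w hw t)).trans
    (mul_le_mul_of_nonneg_left ((v - w).norm_coe_le_norm t) hc.le)

end Superposition

section Primitive

variable {E : Type*} [NormedAddCommGroup E] {a b : ℝ}

/-- A function on `ℝ` that is continuous on `[a, b]`, as an element of the Banach space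
`C([a, b], E)`. -/
def restrictIcc {f : ℝ → E} (hf : ContinuousOn f (Icc a b)) : C(Icc a b, E) :=
  ⟨fun t => f t, hf.domRestrict⟩

@[simp]
theorem restrictIcc_apply {f : ℝ → E} (hf : ContinuousOn f (Icc a b)) (t : Icc a b) :
    restrictIcc hf t = f t := rfl

theorem intervalIntegrable_IccExtend (hab : a ≤ b) (u : C(Icc a b, E)) (s t : ℝ) :
    IntervalIntegrable (IccExtend hab u) volume s t :=
  (u.continuous.Icc_extend' (h := hab)).intervalIntegrable s t

variable [NormedSpace ℝ E]

theorem contDiffOn_one_of_hasDerivWithinAt_Icc (hab : a < b) {f f' : ℝ → E}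
    (hf : ∀ t ∈ Icc a b, HasDerivWithinAt f (f' t) (Icc a b) t) (hf' : ContinuousOn f' (Icc a b)) :
    ContDiffOn ℝ 1 f (Icc a b) :=
  (contDiffOn_one_iff_derivWithin (uniqueDiffOn_Icc hab)).2
    ⟨fun t ht => (hf t ht).differentiableWithinAt,
      hf'.congr fun t ht => (hf t ht).derivWithin (uniqueDiffOn_Icc hab t ht)⟩

theorem integral_IccExtend_congr (hab : a ≤ b) {u : C(Icc a b, E)} {f : ℝ → E}
    (h : ∀ t : Icc a b, u t = f t) {t : ℝ} (ht : t ∈ Icc a b) :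
    ∫ s in a..t, IccExtend hab u s = ∫ s in a..t, f s :=
  intervalIntegral.integral_congr fun s hs => by
    rw [uIcc_of_le ht.1] at hs
    have hs' : s ∈ Icc a b := Icc_subset_Icc_right ht.2 hs
    rw [IccExtend_of_mem _ _ hs', h ⟨s, hs'⟩]

/-- The primitive `t ↦ ∫ₐᵗ u` as a continuous linear operator on `C([a, b], E)`. -/
def primitive (hab : a ≤ b) : C(Icc a b, E) →L[ℝ] C(Icc a b, E) :=
  LinearMap.mkContinuous
    { toFun := fun u => ⟨fun t => ∫ s in a..t, IccExtend hab u s,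
        (intervalIntegral.continuous_primitive (intervalIntegrable_IccExtend hab u) a).comp
          continuous_subtype_val⟩
      map_add' := fun u v => by
        ext t
        exact intervalIntegral.integral_add (intervalIntegrable_IccExtend hab u _ _)
          (intervalIntegrable_IccExtend hab v _ _)
      map_smul' := fun c u => by
        ext t
        exact intervalIntegral.integral_smul c _ } (b - a) fun u => by
    refine (ContinuousMap.norm_le _ (by have := sub_nonneg.2 hab; positivity)).2 fun t => ?_
    refine (intervalIntegral.norm_integral_le_of_norm_le_const
      fun s _ => u.norm_coe_le_norm _).trans ?_
    rw [abs_of_nonneg (sub_nonneg.2 t.2.1), mul_comm]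
    exact mul_le_mul_of_nonneg_right (sub_le_sub_right t.2.2 a) (norm_nonneg _)

theorem primitive_apply (hab : a ≤ b) (u : C(Icc a b, E)) (t : Icc a b) :
    primitive hab u t = ∫ s in a..t, IccExtend hab u s := rfl

/-- The integral `u ↦ ∫ₐᵇ u` as a continuous linear map on `C([a, b], E)`. -/
def integralCLM (hab : a ≤ b) : C(Icc a b, E) →L[ℝ] E :=
  ContinuousMap.evalCLM ℝ (⟨b, right_mem_Icc.2 hab⟩ : Icc a b) ∘L primitive hab

theorem integralCLM_apply_congr (hab : a ≤ b) {u : C(Icc a b, E)} {f : ℝ → E}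
    (h : ∀ t : Icc a b, u t = f t) : integralCLM hab u = ∫ s in a..b, f s :=
  integral_IccExtend_congr hab h (right_mem_Icc.2 hab)

variable [CompleteSpace E]

theorem hasDerivWithinAt_integral_IccExtend (hab : a ≤ b) (u : C(Icc a b, E)) (t : Icc a b) :
    HasDerivWithinAt (fun t => ∫ s in a..t, IccExtend hab u s) (u t) (Icc a b) t := by
  have h := (u.continuous.Icc_extend' (h := hab)).integral_hasStrictDerivAt a t
  rw [IccExtend_val] at h
  exact h.hasDerivAt.hasDerivWithinAt

theorem hasDerivWithinAt_integral_of_continuousOn (hab : a ≤ b) {f : ℝ → E}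
    (hf : ContinuousOn f (Icc a b)) {t : ℝ} (ht : t ∈ Icc a b) :
    HasDerivWithinAt (fun t => ∫ s in a..t, f s) (f t) (Icc a b) t :=
  (hasDerivWithinAt_integral_IccExtend hab (restrictIcc hf) ⟨t, ht⟩).congr_of_mem
    (fun _ hs => (integral_IccExtend_congr hab (restrictIcc_apply hf) hs).symm) ht

theorem integral_eq_sub_of_hasDerivWithinAt_Icc {f f' : ℝ → E}
    (hf : ∀ t ∈ Icc a b, HasDerivWithinAt f (f' t) (Icc a b) t)
    (hf' : ContinuousOn f' (Icc a b)) {t : ℝ} (ht : t ∈ Icc a b) :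
    ∫ s in a..t, f' s = f t - f a := by
  have hsub : Icc a t ⊆ Icc a b := Icc_subset_Icc_right ht.2
  refine intervalIntegral.integral_eq_sub_of_hasDerivAt_of_le ht.1
    (fun s hs => ((hf s (hsub hs)).continuousWithinAt).mono hsub) (fun s hs => ?_)
    ((hf'.mono hsub).intervalIntegrable_of_Icc ht.1)
  exact (hf s (hsub ⟨hs.1.le, hs.2.le⟩)).hasDerivAt (Icc_mem_nhds hs.1 (hs.2.trans_le ht.2))

end Primitive

section LinearODE

variable {E : Type*} [NormedAddCommGroup E] [NormedSpace ℝ E] {a b : ℝ}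

/-- The Volterra operator `u ↦ (t ↦ A t (∫ₐᵗ u))` of a linear differential equation, which acts on
the derivative of the unknown function. -/
def volterra (hab : a ≤ b) (A : C(Icc a b, E →L[ℝ] E)) : C(Icc a b, E) →L[ℝ] C(Icc a b, E) :=
  pointwiseApply A ∘L primitive hab

theorem volterra_apply (hab : a ≤ b) (A : C(Icc a b, E →L[ℝ] E)) (u : C(Icc a b, E))
    (t : Icc a b) : volterra hab A u t = A t (∫ s in a..t, IccExtend hab u s) := rfl

open scoped Nat

theorem norm_volterra_pow_apply_le (hab : a ≤ b) (A : C(Icc a b, E →L[ℝ] E)) (u : C(Icc a b, E))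
    (n : ℕ) (t : Icc a b) :
    ‖(volterra hab A ^ n) u t‖ ≤ (‖A‖ * (t - a)) ^ n / n ! * ‖u‖ := by
  induction n generalizing t with
  | zero => simpa using u.norm_coe_le_norm t
  | succ n ih =>
    have hint : ‖∫ s in a..t, IccExtend hab ((volterra hab A ^ n) u) s‖
        ≤ ∫ s in a..t, (s - a) ^ n * (‖A‖ ^ n / n ! * ‖u‖) := by
      refine intervalIntegral.norm_integral_le_of_norm_le t.2.1 (.of_forall fun s hs => ?_)
        (Continuous.intervalIntegrable (by fun_prop) _ _)
      rw [IccExtend_of_mem _ _ ⟨hs.1.le, hs.2.trans t.2.2⟩]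
      refine (ih _).trans_eq ?_
      rw [mul_pow]
      ring
    have hpow : ∫ s in a..t, (s - a) ^ n = (t - a : ℝ) ^ (n + 1) / (n + 1) := by
      rw [intervalIntegral.integral_comp_sub_right (fun s => s ^ n) a, integral_pow]
      simp
    rw [intervalIntegral.integral_mul_const, hpow] at hint
    rw [pow_succ', mul_apply_eq_comp, volterra_apply]
    refine ((A t).le_of_opNorm_le_of_le (A.norm_coe_le_norm t) hint).trans_eq ?_
    rw [Nat.factorial_succ, Nat.cast_mul, Nat.cast_succ, mul_pow]
    field_simp
    ring

/-- The resolvent of a Volterra operator exists because its iterates decay factorially. -/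
theorem isUnit_one_sub_volterra [CompleteSpace E] (hab : a ≤ b) (A : C(Icc a b, E →L[ℝ] E)) :
    IsUnit (1 - volterra hab A) := by
  have hnorm (n : ℕ) : ‖volterra hab A ^ n‖ ≤ (‖A‖ * (b - a)) ^ n / n ! := by
    have : 0 ≤ b - a := sub_nonneg.2 hab
    refine ContinuousLinearMap.opNorm_le_bound _ (by positivity) fun u =>
      (ContinuousMap.norm_le _ (by positivity)).2 fun t =>
        (norm_volterra_pow_apply_le hab A u n t).trans ?_
    have : 0 ≤ (t : ℝ) - a := sub_nonneg.2 t.2.1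
    gcongr
    exact t.2.2
  obtain ⟨n, hn⟩ := ((FloorSemiring.tendsto_pow_div_factorial_atTop
    (‖A‖ * (b - a))).eventually_lt_const one_pos).exists
  have hunit : IsUnit ((1 - volterra hab A) * ∑ i ∈ Finset.range n, volterra hab A ^ i) := by
    rw [mul_neg_geom_sum]
    exact isUnit_one_sub_of_norm_lt_one (R := C(Icc a b, E) →L[ℝ] C(Icc a b, E))
      ((hnorm n).trans_lt hn)
  refine ((Commute.isUnit_mul_iff ?_).1 hunit).1
  rw [commute_iff_eq, mul_neg_geom_sum, geom_sum_mul_neg]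

variable [CompleteSpace E]

theorem exists_eq_add_volterra (hab : a ≤ b) (A : C(Icc a b, E →L[ℝ] E)) (f : C(Icc a b, E)) :
    ∃ u, u = f + volterra hab A u := by
  obtain ⟨B, hB, -⟩ := isUnit_iff_exists.1 (isUnit_one_sub_volterra hab A)
  refine ⟨B f, eq_add_of_sub_eq ?_⟩
  simpa using DFunLike.congr_fun hB f

theorem exists_linear_ode_solution (hab : a ≤ b) {A : ℝ → E →L[ℝ] E} {f : ℝ → E}
    (hA : ContinuousOn A (Icc a b)) (hf : ContinuousOn f (Icc a b)) (x₀ : E) :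
    ∃ x : ℝ → E, x a = x₀ ∧
      ∀ t ∈ Icc a b, HasDerivWithinAt x (A t (x t) + f t) (Icc a b) t := by
  obtain ⟨u, hu⟩ := exists_eq_add_volterra hab (restrictIcc hA)
    (restrictIcc (hf.add (hA.clm_apply (continuousOn_const (c := x₀)))))
  refine ⟨fun t => x₀ + ∫ s in a..t, IccExtend hab u s, by simp, fun t ht => ?_⟩
  refine ((hasDerivWithinAt_integral_IccExtend hab u ⟨t, ht⟩).const_add x₀).congr_deriv ?_
  rw [hu, ContinuousMap.add_apply, ← hu, volterra_apply, restrictIcc_apply, restrictIcc_apply,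
    map_add]
  simp only [Pi.add_apply]
  abel

theorem exists_linear_ode_solution_of_terminal (hab : a ≤ b) {A : ℝ → E →L[ℝ] E} {f : ℝ → E}
    (hA : ContinuousOn A (Icc a b)) (hf : ContinuousOn f (Icc a b)) (x₁ : E) :
    ∃ x : ℝ → E, x b = x₁ ∧
      ∀ t ∈ Icc a b, HasDerivWithinAt x (A t (x t) + f t) (Icc a b) t := by
  have hmaps : MapsTo (fun t => a + b - t) (Icc a b) (Icc a b) := fun t ht => by
    constructor <;> linarith [ht.1, ht.2]
  have hcont : ContinuousOn (fun t : ℝ => a + b - t) (Icc a b) := by fun_prop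
  obtain ⟨z, hza, hz⟩ := exists_linear_ode_solution hab (A := fun t => -A (a + b - t))
    (f := fun t => -f (a + b - t)) (hA.comp hcont hmaps).neg (hf.comp hcont hmaps).neg x₁
  refine ⟨fun t => z (a + b - t), by simpa using hza, fun t ht => ?_⟩
  have h := (hz (a + b - t) (hmaps ht)).scomp t
    (((hasDerivAt_id t).const_sub (a + b)).hasDerivWithinAt (s := Icc a b)) hmaps
  refine h.congr_deriv ?_
  rw [neg_apply, sub_sub_cancel]
  module

end LinearODE

section FundamentalLemma

variable {E : Type*} [NormedAddCommGroup E] [NormedSpace ℝ E] [CompleteSpace E] {a b : ℝ}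

theorem eqOn_zero_of_forall_integral_smul_eq_zero (hab : a < b) {f : ℝ → E}
    (hf : ContinuousOn f (Icc a b))
    (h : ∀ η : ℝ → ℝ, Continuous η → ∫ t in a..b, η t • f t = 0) :
    ∀ t ∈ Icc a b, f t = 0 := by
  have hae : ∀ᵐ t, t ∈ Ioo a b → f t = 0 := by
    refine isOpen_Ioo.ae_eq_zero_of_integral_contDiff_smul_eq_zero
      (hf.mono Ioo_subset_Icc_self |>.locallyIntegrableOn measurableSet_Ioo)
      fun η hη _ hsupp => ?_
    rw [← h η hη.continuous, intervalIntegral.integral_of_le hab.le,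
      setIntegral_eq_integral_of_forall_compl_eq_zero]
    intro t ht
    rw [image_eq_zero_of_notMem_tsupport fun hmem => ht (Ioo_subset_Ioc_self (hsupp hmem)),
      zero_smul]
  refine Measure.eqOn_Icc_of_ae_eq volume hab.ne ?_ hf continuousOn_const
  rw [Measure.restrict_congr_set Ioo_ae_eq_Icc.symm]
  exact (ae_restrict_iff' measurableSet_Ioo).2 hae

/-- Every continuous function of mean value zero is the derivative of an admissible variation, so
`h` minus its mean value is orthogonal to every continuous function. -/
theorem exists_eqOn_const_of_forall_integral_deriv_smul_eq_zero (hab : a < b) {h : ℝ → E}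
    (hh : ContinuousOn h (Icc a b))
    (hη : ∀ η : ℝ → ℝ, ContDiff ℝ 1 η → η a = 0 → η b = 0 → ∫ t in a..b, deriv η t • h t = 0) :
    ∃ c, ∀ t ∈ Icc a b, h t = c := by
  have hba : b - a ≠ 0 := sub_ne_zero.2 hab.ne'
  refine ⟨(b - a)⁻¹ • ∫ t in a..b, h t, fun t ht => sub_eq_zero.1 ?_⟩
  refine eqOn_zero_of_forall_integral_smul_eq_zero hab
    (f := fun t => h t - (b - a)⁻¹ • ∫ t in a..b, h t) (hh.sub continuousOn_const)
    (fun φ hφ => ?_) t ht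
  set m : ℝ := (b - a)⁻¹ * ∫ t in a..b, φ t
  have hderiv (t : ℝ) : HasDerivAt (fun t => ∫ s in a..t, (φ s - m)) (φ t - m) t :=
    ((hφ.sub continuous_const).integral_hasStrictDerivAt a t).hasDerivAt
  have hderiv_eq : deriv (fun t => ∫ s in a..t, (φ s - m)) = fun t => φ t - m :=
    funext fun t => (hderiv t).deriv
  have hend : ∫ s in a..b, (φ s - m) = 0 := by
    rw [intervalIntegral.integral_sub (hφ.intervalIntegrable _ _) intervalIntegrable_const,
      intervalIntegral.integral_const, smul_eq_mul, mul_inv_cancel_left₀ hba, sub_self]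
  have horth := hη (fun t => ∫ s in a..t, (φ s - m)) (contDiff_one_iff_deriv.2
    ⟨fun t => (hderiv t).differentiableAt, by rw [hderiv_eq]; fun_prop⟩)
    intervalIntegral.integral_same hend
  have hφh : IntervalIntegrable (fun t => φ t • h t) volume a b :=
    (hφ.continuousOn.smul hh).intervalIntegrable_of_Icc hab.le
  have hmh : IntervalIntegrable (fun t => m • h t) volume a b :=
    (hh.intervalIntegrable_of_Icc hab.le).smul m
  have hφm : IntervalIntegrable (fun t => φ t • (b - a)⁻¹ • ∫ s in a..b, h s) volume a b :=
    (hφ.smul continuous_const).intervalIntegrable _ _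
  simp only [hderiv_eq, sub_smul] at horth
  rw [intervalIntegral.integral_sub hφh hmh, intervalIntegral.integral_smul] at horth
  simp only [smul_sub]
  rw [intervalIntegral.integral_sub hφh hφm,
    intervalIntegral.integral_smul_const, smul_smul, mul_comm, ← horth]

theorem hasDerivWithinAt_of_forall_integral_eq_zero (hab : a < b) {f g : ℝ → E}
    (hf : ContinuousOn f (Icc a b)) (hg : ContinuousOn g (Icc a b))
    (h : ∀ η : ℝ → ℝ, ContDiff ℝ 1 η → η a = 0 → η b = 0 →
      ∫ t in a..b, (η t • f t + deriv η t • g t) = 0) :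
    ∀ t ∈ Icc a b, HasDerivWithinAt g (f t) (Icc a b) t := by
  set F : ℝ → E := fun t => ∫ s in a..t, f s
  have hF : ∀ t ∈ Icc a b, HasDerivWithinAt F (f t) (Icc a b) t := fun t ht =>
    hasDerivWithinAt_integral_of_continuousOn hab.le hf ht
  have hFc : ContinuousOn F (Icc a b) := fun t ht => (hF t ht).continuousWithinAt
  obtain ⟨c, hc⟩ := exists_eqOn_const_of_forall_integral_deriv_smul_eq_zero hab
    (h := fun t => g t - F t) (hg.sub hFc)
    fun η hη hηa hηb => by
      have hη' : ContinuousOn (deriv η) (Icc a b) := (hη.continuous_deriv le_rfl).continuousOn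
      have hparts : ∫ t in a..b, (η t • f t + deriv η t • F t) = η b • F b - η a • F a :=
        integral_eq_sub_of_hasDerivWithinAt_Icc
          (fun t ht => ((hη.differentiable one_ne_zero t).hasDerivAt.hasDerivWithinAt).smul
            (hF t ht))
          ((hη.continuous.continuousOn.smul hf).add (hη'.smul hFc)) (right_mem_Icc.2 hab.le)
      rw [hηa, hηb, zero_smul, zero_smul, sub_zero] at hparts
      have hint (k : ℝ → E) (hk : ContinuousOn k (Icc a b)) :
          IntervalIntegrable (fun t => η t • f t + deriv η t • k t) volume a b :=
        ((hη.continuous.continuousOn.smul hf).add (hη'.smul hk)).intervalIntegrable_of_Icc hab.le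
      have hsub := intervalIntegral.integral_sub (hint g hg) (hint F hFc)
      rw [h η hη hηa hηb, hparts, sub_zero] at hsub
      simpa only [add_sub_add_left_eq_sub, ← smul_sub] using hsub
  refine fun t ht => ((hF t ht).const_add c).congr_of_mem (fun s hs => ?_) ht
  rw [← hc s hs, sub_add_cancel]

end FundamentalLemma

section Stationary

variable {Z P F : Type*} [NormedAddCommGroup Z] [NormedSpace ℝ Z] [NormedAddCommGroup P]
  [NormedSpace ℝ P] [NormedAddCommGroup F] [NormedSpace ℝ F] {a b : ℝ}

theorem forall_integral_clm_apply_eq_zero_iff [CompleteSpace F] (hab : a < b) {h : ℝ → P →L[ℝ] F}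
    (hh : ContinuousOn h (Icc a b)) :
    (∀ δ : ℝ → P, Continuous δ → ∫ t in a..b, h t (δ t) = 0) ↔ ∀ t ∈ Icc a b, h t = 0 := by
  refine ⟨fun hδ => eqOn_zero_of_forall_integral_smul_eq_zero hab hh fun η hη => ?_,
    fun h0 δ _ => ?_⟩
  · ext e
    have hint : IntervalIntegrable (fun t => η t • h t) volume a b :=
      (hη.continuousOn.smul hh).intervalIntegrable_of_Icc hab.le
    rw [ContinuousLinearMap.intervalIntegral_apply hint]
    simpa only [map_smul, smul_apply, zero_apply] using hδ (fun t => η t • e) (by fun_prop)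
  · refine intervalIntegral.integral_zero_ae (.of_forall fun t ht => ?_)
    rw [uIoc_of_le hab.le] at ht
    rw [h0 t (Ioc_subset_Icc_self ht), zero_apply]

theorem forall_integral_clm_apply_add_deriv_eq_zero_iff [CompleteSpace F] (hab : a < b)
    {f g : ℝ → Z →L[ℝ] F} (hf : ContinuousOn f (Icc a b)) (hg : ContinuousOn g (Icc a b)) :
    (∀ δ : ℝ → Z, ContDiff ℝ 1 δ → δ a = 0 → δ b = 0 →
      ∫ t in a..b, (f t (δ t) + g t (deriv δ t)) = 0) ↔
    ∀ t ∈ Icc a b, HasDerivWithinAt g (f t) (Icc a b) t := by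
  refine ⟨fun hδ => hasDerivWithinAt_of_forall_integral_eq_zero hab hf hg fun η hη ha hb => ?_,
    fun hgf δ hδ ha hb => ?_⟩
  · ext e
    have hη' : Continuous (deriv η) := hη.continuous_deriv le_rfl
    have hint : IntervalIntegrable (fun t => η t • f t + deriv η t • g t) volume a b :=
      ((hη.continuous.continuousOn.smul hf).add
        (hη'.continuousOn.smul hg)).intervalIntegrable_of_Icc hab.le
    have hderiv (t : ℝ) : deriv (fun t => η t • e) t = deriv η t • e :=
      deriv_smul_const (hη.differentiable one_ne_zero t) e
    rw [ContinuousLinearMap.intervalIntegral_apply hint]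
    simpa only [hderiv, map_smul, add_apply, smul_apply, zero_apply] using
      hδ (fun t => η t • e) (hη.smul contDiff_const) (by rw [ha, zero_smul])
        (by rw [hb, zero_smul])
  · have hcont : ContinuousOn (fun t => f t (δ t) + g t (deriv δ t)) (Icc a b) :=
      (hf.clm_apply hδ.continuous.continuousOn).add
        (hg.clm_apply (hδ.continuous_deriv le_rfl).continuousOn)
    rw [integral_eq_sub_of_hasDerivWithinAt_Icc (f := fun t => g t (δ t))
      (fun t ht => (hgf t ht).clm_apply
        (hδ.differentiable one_ne_zero t).hasDerivAt.hasDerivWithinAt)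
      hcont (right_mem_Icc.2 hab.le), ha, hb, map_zero, map_zero, sub_zero]

theorem forall_integral_clm_apply_add_eq_zero_iff [CompleteSpace F] (hab : a < b)
    {f g : ℝ → Z →L[ℝ] F} {h : ℝ → P →L[ℝ] F} (hf : ContinuousOn f (Icc a b))
    (hg : ContinuousOn g (Icc a b)) (hh : ContinuousOn h (Icc a b)) :
    (∀ (δz : ℝ → Z) (δp : ℝ → P), ContDiff ℝ 1 δz → Continuous δp → δz a = 0 → δz b = 0 →
      ∫ t in a..b, (f t (δz t) + g t (deriv δz t) + h t (δp t)) = 0) ↔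
    (∀ t ∈ Icc a b, HasDerivWithinAt g (f t) (Icc a b) t) ∧ ∀ t ∈ Icc a b, h t = 0 := by
  rw [← forall_integral_clm_apply_add_deriv_eq_zero_iff hab hf hg,
    ← forall_integral_clm_apply_eq_zero_iff hab hh]
  refine ⟨fun hδ => ⟨fun δz hz ha hb => ?_, fun δp hp => ?_⟩,
    fun ⟨hδz, hδp⟩ δz δp hz hp ha hb => ?_⟩
  · simpa using hδ δz 0 hz continuous_const ha hb
  · simpa using hδ 0 δp contDiff_const hp rfl rfl
  · have hz' : IntervalIntegrable (fun t => f t (δz t) + g t (deriv δz t)) volume a b :=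
      ((hf.clm_apply hz.continuous.continuousOn).add (hg.clm_apply
        (hz.continuous_deriv le_rfl).continuousOn)).intervalIntegrable_of_Icc hab.le
    rw [intervalIntegral.integral_add hz'
      ((hh.clm_apply hp.continuousOn).intervalIntegrable_of_Icc hab.le), hδz δz hz ha hb,
      hδp δp hp, add_zero]

theorem hasDerivAt_integral_comp_add_smul (hab : a ≤ b) {M : Z → F} {O : Set Z} (hO : IsOpen O)
    (hM : ContDiffOn ℝ 1 M O) {c δ : ℝ → Z} (hc : ContinuousOn c (Icc a b))
    (hδ : ContinuousOn δ (Icc a b)) (hcO : ∀ t ∈ Icc a b, c t ∈ O) :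
    HasDerivAt (fun ε : ℝ => ∫ t in a..b, M (c t + ε • δ t))
      (∫ t in a..b, fderiv ℝ M (c t) (δ t)) 0 := by
  have hfderiv : ContinuousOn (fun t => fderiv ℝ M (c t)) (Icc a b) :=
    (hM.continuousOn_fderiv_of_isOpen hO le_rfl).comp hc hcO
  have hline : HasDerivAt (fun ε : ℝ => restrictIcc hc + ε • restrictIcc hδ)
      (restrictIcc hδ) 0 := by
    simpa using ((hasDerivAt_id (0 : ℝ)).smul_const (restrictIcc hδ)).const_add (restrictIcc hc)
  have hsuper : HasFDerivAt (superpose M) (pointwiseApply (restrictIcc hfderiv))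
      (restrictIcc hc + (0 : ℝ) • restrictIcc hδ) := by
    rw [zero_smul, add_zero]
    exact (hasStrictFDerivAt_superpose hO hM (u := restrictIcc hc) (fun t => hcO t t.2)
      fun t => rfl).hasFDerivAt
  have hcomp := (integralCLM hab).hasFDerivAt.comp_hasDerivAt (0 : ℝ)
    (hsuper.comp_hasDerivAt (0 : ℝ) hline)
  have hmem : ∀ᶠ ε : ℝ in 𝓝 0, MapsTo (restrictIcc hc + ε • restrictIcc hδ) univ O := by
    refine hline.continuousAt.eventually (ContinuousMap.eventually_mapsTo isCompact_univ hO ?_)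
    simpa [MapsTo] using hcO
  rw [integralCLM_apply_congr hab (f := fun t => fderiv ℝ M (c t) (δ t)) fun t => rfl] at hcomp
  refine hcomp.congr_of_eventuallyEq ?_
  filter_upwards [hmem] with ε hε
  exact (integralCLM_apply_congr hab fun t =>
    superpose_apply hM.continuousOn (fun s => hε (mem_univ s)) t).symm

/-- Stationarity at `(z, p)` of the action `∫ₐᵇ M(z, ż, p) dt` under `C¹` variations of `z` with
fixed end points and continuous variations of `p`. The velocity `ż` is a separate argument, since
the curves matter on `[a, b]` only. -/
def IsStationary (a b : ℝ) (M : Z × Z × P → ℝ) (z z' : ℝ → Z) (p : ℝ → P) : Prop :=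
  ∀ (δz : ℝ → Z) (δp : ℝ → P), ContDiff ℝ 1 δz → Continuous δp → δz a = 0 → δz b = 0 →
    HasDerivAt (fun ε : ℝ => ∫ t in a..b,
      M (z t + ε • δz t, z' t + ε • deriv δz t, p t + ε • δp t)) 0 0

theorem IsStationary.congr_velocity {M : Z × Z × P → ℝ} {z z' w : ℝ → Z}
    {p : ℝ → P} (hab : a ≤ b) (h : IsStationary a b M z z' p) (hw : EqOn w z' (Icc a b)) :
    IsStationary a b M z w p := fun δz δp hδz hδp ha hb =>
  (h δz δp hδz hδp ha hb).congr_of_eventuallyEq <| .of_forall fun ε =>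
    intervalIntegral.integral_congr fun t ht => by
      rw [uIcc_of_le hab] at ht
      simp only [hw ht]

variable {M : Z × Z × P → ℝ} {O : Set (Z × Z × P)} {z z' : ℝ → Z} {p : ℝ → P}

theorem isStationary_iff_forall_integral_eq_zero (hab : a ≤ b) (hO : IsOpen O)
    (hM : ContDiffOn ℝ 1 M O) (hc : ContinuousOn (fun t => (z t, z' t, p t)) (Icc a b))
    (hcO : ∀ t ∈ Icc a b, (z t, z' t, p t) ∈ O) :
    IsStationary a b M z z' p ↔
      ∀ (δz : ℝ → Z) (δp : ℝ → P), ContDiff ℝ 1 δz → Continuous δp → δz a = 0 → δz b = 0 →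
        ∫ t in a..b, fderiv ℝ M (z t, z' t, p t) (δz t, deriv δz t, δp t) = 0 := by
  refine forall_congr' fun δz => forall_congr' fun δp => forall_congr' fun hz =>
    forall_congr' fun hp => forall_congr' fun _ => forall_congr' fun _ => ?_
  have hderiv := hasDerivAt_integral_comp_add_smul hab hO hM hc
    (δ := fun t => (δz t, deriv δz t, δp t))
    (hz.continuous.prodMk ((hz.continuous_deriv le_rfl).prodMk hp)).continuousOn hcO
  exact ⟨fun h => hderiv.unique h, fun h => hderiv.congr_deriv h⟩

theorem isStationary_iff_eulerLagrange (hab : a < b) (hO : IsOpen O) (hM : ContDiffOn ℝ 1 M O)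
    (hc : ContinuousOn (fun t => (z t, z' t, p t)) (Icc a b))
    (hcO : ∀ t ∈ Icc a b, (z t, z' t, p t) ∈ O) :
    IsStationary a b M z z' p ↔
      (∀ t ∈ Icc a b, HasDerivWithinAt
        (fun s => fderiv ℝ M (z s, z' s, p s) ∘L .inr ℝ Z (Z × P) ∘L .inl ℝ Z P)
        (fderiv ℝ M (z t, z' t, p t) ∘L .inl ℝ Z (Z × P)) (Icc a b) t) ∧
      ∀ t ∈ Icc a b, fderiv ℝ M (z t, z' t, p t) ∘L .inr ℝ Z (Z × P) ∘L .inr ℝ Z P = 0 := by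
  have hfderiv : ContinuousOn (fun t => fderiv ℝ M (z t, z' t, p t)) (Icc a b) :=
    (hM.continuousOn_fderiv_of_isOpen hO le_rfl).comp hc hcO
  rw [isStationary_iff_forall_integral_eq_zero hab.le hO hM hc hcO,
    ← forall_integral_clm_apply_add_eq_zero_iff hab (hfderiv.clm_comp continuousOn_const)
      (hfderiv.clm_comp continuousOn_const) (hfderiv.clm_comp continuousOn_const)]
  simp only [ContinuousLinearMap.comp_apply, ContinuousLinearMap.inl_apply,
    ContinuousLinearMap.inr_apply, ← map_add, Prod.mk_add_mk, add_zero, zero_add]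

end Stationary

theorem hasDerivWithinAt_congr_iff {E : Type*} [NormedAddCommGroup E] [NormedSpace ℝ E]
    {f g : ℝ → E} {f' g' : E} {s : Set ℝ} {t : ℝ} (ht : t ∈ s) (hfg : EqOn f g s) (h' : f' = g') :
    HasDerivWithinAt f f' s t ↔ HasDerivWithinAt g g' s t :=
  h' ▸ ⟨fun h => h.congr hfg.symm (hfg ht).symm, fun h => h.congr hfg (hfg ht)⟩

theorem hasDerivWithinAt_clm_iff_basis {ι E F : Type*} [Finite ι] [NormedAddCommGroup E]
    [NormedSpace ℝ E] [NormedAddCommGroup F] [NormedSpace ℝ F] (e : Module.Basis ι ℝ E)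
    {f : ℝ → E →L[ℝ] F} {f' : E →L[ℝ] F} {s : Set ℝ} {t : ℝ} :
    HasDerivWithinAt f f' s t ↔ ∀ i, HasDerivWithinAt (fun t => f t (e i)) (f' (e i)) s t := by
  refine ⟨fun h i => ?_, fun h => ?_⟩
  · simpa using h.clm_apply (hasDerivWithinAt_const t s (e i))
  classical
  have := Fintype.ofFinite ι
  have : FiniteDimensional ℝ E := e.finiteDimensional_of_finite
  let c (i : ι) : E →L[ℝ] ℝ := (e.coord i).toContinuousLinearMap
  have expand (g : E →L[ℝ] F) : g = ∑ i, (c i).smulRightL ℝ E F (g (e i)) := by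
    refine ContinuousLinearMap.coe_injective (e.ext fun j => ?_)
    simp [c, Finsupp.single_apply]
  rw [funext fun t => expand (f t), expand f']
  exact HasDerivWithinAt.fun_sum fun i _ =>
    ((c i).smulRightL ℝ E F).hasFDerivAt.comp_hasDerivWithinAt t (h i)

section AugmentedLagrangian

variable {X Y P : Type*} [NormedAddCommGroup X] [NormedSpace ℝ X] [NormedAddCommGroup Y]
  [NormedSpace ℝ Y] [NormedAddCommGroup P] [NormedSpace ℝ P]

/-- The Lagrangian `μ L(x, y, ẏ) + ⟨p, ẋ - R(x, y, ẏ)⟩` of the problem of minimizing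
`∫ L(x, y, ẏ) dt` under the constraint `ẋ = R(x, y, ẏ)`, as a function of `((x, y), (ẋ, ẏ), p)`.
The pairing of a multiplier `p` with `X` is given by `B`. -/
def augmentedLagrangian (μ : ℝ) (L : X × Y × Y → ℝ) (R : X × Y × Y → X)
    (B : P →L[ℝ] X →L[ℝ] ℝ) (c : (X × Y) × (X × Y) × P) : ℝ :=
  μ * L (c.1.1, c.1.2, c.2.1.2) + B c.2.2 (c.2.1.1 - R (c.1.1, c.1.2, c.2.1.2))

variable {L : X × Y × Y → ℝ} {R : X × Y × Y → X} {Ω : Set (X × Y × Y)}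

theorem contDiffOn_augmentedLagrangian (hL : ContDiffOn ℝ 1 L Ω) (hR : ContDiffOn ℝ 1 R Ω) (μ : ℝ)
    (B : P →L[ℝ] X →L[ℝ] ℝ) : ContDiffOn ℝ 1 (augmentedLagrangian μ L R B)
      ((fun c : (X × Y) × (X × Y) × P => (c.1.1, c.1.2, c.2.1.2)) ⁻¹' Ω) := by
  have hjet : ContDiff ℝ 1 fun c : (X × Y) × (X × Y) × P => (c.1.1, c.1.2, c.2.1.2) := by fun_prop
  have hB : ContDiff ℝ 1 fun c : (X × Y) × (X × Y) × P => B c.2.2 := by fun_prop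
  have hw : ContDiff ℝ 1 fun c : (X × Y) × (X × Y) × P => c.2.1.1 := by fun_prop
  exact (contDiffOn_const.mul (hL.comp hjet.contDiffOn fun _ h => h)).add
    (hB.contDiffOn.clm_apply (hw.contDiffOn.sub (hR.comp hjet.contDiffOn fun _ h => h)))

theorem fderiv_augmentedLagrangian_apply (μ : ℝ) (B : P →L[ℝ] X →L[ℝ] ℝ) {x w : X} {y v : Y} {p : P}
    (hL : DifferentiableAt ℝ L (x, y, v)) (hR : DifferentiableAt ℝ R (x, y, v))
    (δx δw : X) (δy δv : Y) (δp : P) :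
    fderiv ℝ (augmentedLagrangian μ L R B) ((x, y), (w, v), p) ((δx, δy), (δw, δv), δp)
      = μ * fderiv ℝ L (x, y, v) (δx, δy, δv)
        + B p (δw - fderiv ℝ R (x, y, v) (δx, δy, δv)) + B δp (w - R (x, y, v)) := by
  let c : (X × Y) × (X × Y) × P := ((x, y), (w, v), p)
  let jet : (X × Y) × (X × Y) × P →L[ℝ] X × Y × Y :=
    (.fst ℝ X Y ∘L .fst ℝ _ _).prod ((.snd ℝ X Y ∘L .fst ℝ _ _).prod
      (.snd ℝ X Y ∘L .fst ℝ _ P ∘L .snd ℝ (X × Y) _))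
  let base : (X × Y) × (X × Y) × P →L[ℝ] X := .fst ℝ X Y ∘L .fst ℝ _ P ∘L .snd ℝ (X × Y) _
  let multiplier : (X × Y) × (X × Y) × P →L[ℝ] P := .snd ℝ _ P ∘L .snd ℝ (X × Y) _
  have hL' : HasFDerivAt (L ∘ jet) (fderiv ℝ L (x, y, v) ∘L jet) c :=
    hL.hasFDerivAt.comp c jet.hasFDerivAt
  have hR' : HasFDerivAt (R ∘ jet) (fderiv ℝ R (x, y, v) ∘L jet) c :=
    hR.hasFDerivAt.comp c jet.hasFDerivAt
  have hderiv := (hL'.const_mul μ).add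
    (((B ∘L multiplier).hasFDerivAt (x := c)).clm_apply (base.hasFDerivAt.sub hR'))
  refine (DFunLike.congr_fun hderiv.fderiv _).trans ?_
  simp only [ContinuousLinearMap.comp_apply, ContinuousLinearMap.coe_snd',
    ContinuousLinearMap.comp_sub, Pi.sub_apply, ContinuousLinearMap.coe_fst',
    Function.comp_apply, ContinuousLinearMap.prod_apply, map_sub, add_apply, smul_apply,
    smul_eq_mul, sub_apply, ContinuousLinearMap.flip_apply, c, jet, base, multiplier]
  ring

variable {a b : ℝ} {x w : ℝ → X} {y v : ℝ → Y} {p : ℝ → P}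

theorem isStationary_augmentedLagrangian_iff {ι κ : Type*} [Finite ι] [Finite κ]
    (e : Module.Basis ι ℝ X) (e' : Module.Basis κ ℝ Y) (hab : a < b) (hΩ : IsOpen Ω)
    (hL : ContDiffOn ℝ 1 L Ω) (hR : ContDiffOn ℝ 1 R Ω) {μ : ℝ} {B : P →L[ℝ] X →L[ℝ] ℝ}
    (hB : ∀ x, (∀ p, B p x = 0) → x = 0)
    (hx : ContinuousOn x (Icc a b)) (hy : ContinuousOn y (Icc a b)) (hw : ContinuousOn w (Icc a b))
    (hv : ContinuousOn v (Icc a b)) (hp : ContinuousOn p (Icc a b))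
    (hΩc : ∀ t ∈ Icc a b, (x t, y t, v t) ∈ Ω) :
    IsStationary a b (augmentedLagrangian μ L R B) (fun t => (x t, y t)) (fun t => (w t, v t)) p ↔
      ((∀ t ∈ Icc a b, ∀ i, HasDerivWithinAt (fun s => B (p s) (e i))
          (μ * fderiv ℝ L (x t, y t, v t) (e i, 0, 0)
            - B (p t) (fderiv ℝ R (x t, y t, v t) (e i, 0, 0))) (Icc a b) t) ∧
        ∀ t ∈ Icc a b, ∀ k, HasDerivWithinAt
          (fun s => μ * fderiv ℝ L (x s, y s, v s) (0, 0, e' k)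
            - B (p s) (fderiv ℝ R (x s, y s, v s) (0, 0, e' k)))
          (μ * fderiv ℝ L (x t, y t, v t) (0, e' k, 0)
            - B (p t) (fderiv ℝ R (x t, y t, v t) (0, e' k, 0))) (Icc a b) t) ∧
      ∀ t ∈ Icc a b, w t = R (x t, y t, v t) := by
  rw [isStationary_iff_eulerLagrange hab (hΩ.preimage (by fun_prop))
    (contDiffOn_augmentedLagrangian hL hR μ B) ((hx.prodMk hy).prodMk ((hw.prodMk hv).prodMk hp))
    hΩc]
  have happly : ∀ s ∈ Icc a b, ∀ δx δw δy δv δp, fderiv ℝ (augmentedLagrangian μ L R B)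
      ((x s, y s), (w s, v s), p s) ((δx, δy), (δw, δv), δp)
        = μ * fderiv ℝ L (x s, y s, v s) (δx, δy, δv)
          + B (p s) (δw - fderiv ℝ R (x s, y s, v s) (δx, δy, δv))
          + B δp (w s - R (x s, y s, v s)) := fun s hs =>
    have hnhds := hΩ.mem_nhds (hΩc s hs)
    fderiv_augmentedLagrangian_apply μ B ((hL.contDiffAt hnhds).differentiableAt one_ne_zero)
      ((hR.contDiffAt hnhds).differentiableAt one_ne_zero)
  have hzero (c : (X × Y) × (X × Y) × P →L[ℝ] ℝ) : c ∘L .inr ℝ (X × Y) _ ∘L .inr ℝ (X × Y) P = 0 ↔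
      ∀ δp, c ((0, 0), (0, 0), δp) = 0 := ContinuousLinearMap.ext_iff
  have hℝ (c : X × Y × Y →L[ℝ] ℝ) : c (0, 0, 0) = 0 := map_zero c
  have hX (c : X × Y × Y →L[ℝ] X) : c (0, 0, 0) = 0 := map_zero c
  refine and_congr ?_ (forall₂_congr fun t ht => ?_)
  · rw [← forall₂_and]
    refine forall₂_congr fun t ht => ?_
    rw [hasDerivWithinAt_clm_iff_basis (e.prod e'), Sum.forall]
    refine and_congr
      (forall_congr' fun i => hasDerivWithinAt_congr_iff ht (fun s hs => ?_) ?_)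
      (forall_congr' fun k => hasDerivWithinAt_congr_iff ht (fun s hs => ?_) ?_)
    · simp [happly s hs, hℝ, hX, ← Prod.mk_zero_zero]
    · simp [happly t ht, ← Prod.mk_zero_zero, sub_eq_add_neg]
    · simp [happly s hs, ← Prod.mk_zero_zero, sub_eq_add_neg]
    · simp [happly t ht, ← Prod.mk_zero_zero, sub_eq_add_neg]
  · rw [hzero, ← sub_eq_zero]
    simp only [happly t ht, hℝ, hX, sub_zero, map_zero, mul_zero, zero_add]
    exact ⟨hB _, fun h δp => by rw [h, map_zero]⟩

end AugmentedLagrangian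

section Multipliers

variable {X Y : Type*} [NormedAddCommGroup X] [NormedSpace ℝ X] [NormedAddCommGroup Y]
  [NormedSpace ℝ Y] {a b : ℝ}

/-- The curve `(∫ w, ∫ v, v)` in `X × Y × Y` as a continuous linear function of the velocities
`(w, v)`. -/
def velocityLift (hab : a ≤ b) :
    C(Icc a b, X) × C(Icc a b, Y) →L[ℝ] C(Icc a b, X × Y × Y) :=
  (ContinuousLinearMap.inl ℝ X (Y × Y)).compLeftContinuous ℝ _ ∘L primitive hab ∘L .fst ℝ _ _
    + ((ContinuousLinearMap.inr ℝ X (Y × Y) ∘L .inl ℝ Y Y).compLeftContinuous ℝ _ ∘L primitive hab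
      + (ContinuousLinearMap.inr ℝ X (Y × Y) ∘L .inr ℝ Y Y).compLeftContinuous ℝ _) ∘L .snd ℝ _ _

theorem velocityLift_apply (hab : a ≤ b) (p : C(Icc a b, X) × C(Icc a b, Y)) (t : Icc a b) :
    velocityLift hab p t = (primitive hab p.1 t, primitive hab p.2 t, p.2 t) := by
  simp [velocityLift]

theorem velocityLift_restrictIcc [CompleteSpace X] [CompleteSpace Y] (hab : a ≤ b) {x w : ℝ → X}
    {y v : ℝ → Y} (hw : ContinuousOn w (Icc a b)) (hv : ContinuousOn v (Icc a b))
    (hx : ∀ t ∈ Icc a b, HasDerivWithinAt x (w t) (Icc a b) t)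
    (hy : ∀ t ∈ Icc a b, HasDerivWithinAt y (v t) (Icc a b) t) (t : Icc a b) :
    velocityLift hab (restrictIcc hw, restrictIcc hv) t = (x t - x a, y t - y a, v t) := by
  simp only [velocityLift_apply, primitive_apply, restrictIcc_apply,
    integral_IccExtend_congr hab (restrictIcc_apply hw) t.2,
    integral_IccExtend_congr hab (restrictIcc_apply hv) t.2,
    integral_eq_sub_of_hasDerivWithinAt_Icc hx hw t.2,
    integral_eq_sub_of_hasDerivWithinAt_Icc hy hv t.2]

/-- The curve `(x, y, ẏ)` that starts at `x₀`, `y₀` and has velocities `(ẋ, ẏ) = p`. -/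
def velocityCurve (hab : a ≤ b) (x₀ : X) (y₀ : Y) (p : C(Icc a b, X) × C(Icc a b, Y)) :
    C(Icc a b, X × Y × Y) :=
  ContinuousMap.const _ (x₀, y₀, 0) + velocityLift hab p

theorem velocityCurve_apply (hab : a ≤ b) (x₀ : X) (y₀ : Y) (p : C(Icc a b, X) × C(Icc a b, Y))
    (t : Icc a b) : velocityCurve hab x₀ y₀ p t
      = (x₀ + primitive hab p.1 t, y₀ + primitive hab p.2 t, p.2 t) := by
  simp [velocityCurve, velocityLift_apply]

theorem hasStrictFDerivAt_velocityCurve (hab : a ≤ b) (x₀ : X) (y₀ : Y)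
    (p : C(Icc a b, X) × C(Icc a b, Y)) :
    HasStrictFDerivAt (velocityCurve hab x₀ y₀) (velocityLift hab) p :=
  (velocityLift (X := X) (Y := Y) hab).hasStrictFDerivAt.const_add
    (ContinuousMap.const _ (x₀, y₀, 0))

/-- The equations of motion `ẋ = R(x, y, ẏ)`, with the velocity `v = ẏ` recorded as a continuous
function on `[a, b]`. -/
structure IsTrajectory (a b : ℝ) (R : X × Y × Y → X) (x : ℝ → X) (y v : ℝ → Y) : Prop where
  continuousOn_velocity : ContinuousOn v (Icc a b)
  base : ∀ t ∈ Icc a b, HasDerivWithinAt x (R (x t, y t, v t)) (Icc a b) t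
  fibre : ∀ t ∈ Icc a b, HasDerivWithinAt y (v t) (Icc a b) t

theorem IsTrajectory.continuousOn {R : X × Y × Y → X} {x : ℝ → X} {y v : ℝ → Y}
    (h : IsTrajectory a b R x y v) : ContinuousOn (fun t => (x t, y t, v t)) (Icc a b) :=
  .prodMk (fun t ht => (h.base t ht).continuousWithinAt)
    (.prodMk (fun t ht => (h.fibre t ht).continuousWithinAt) h.continuousOn_velocity)

/-- `(x, y)` minimizes `∫ L(x, y, ẏ)` among the trajectories of `ẋ = R(x, y, ẏ)` with the same end
points that are uniformly close to it together with `ẏ`. -/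
def IsWeakLocalMin (a b : ℝ) (L : X × Y × Y → ℝ) (R : X × Y × Y → X) (x : ℝ → X)
    (y v : ℝ → Y) : Prop :=
  IsTrajectory a b R x y v ∧ ∃ δ > 0, ∀ x' y' v', IsTrajectory a b R x' y' v' →
    x' a = x a → y' a = y a → x' b = x b → y' b = y b →
    (∀ t ∈ Icc a b, dist (x' t, y' t, v' t) (x t, y t, v t) < δ) →
    ∫ t in a..b, L (x t, y t, v t) ≤ ∫ t in a..b, L (x' t, y' t, v' t)

/-- The constraint `ẋ - R(x, y, ẏ)` together with the displacement of the end points, as a function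
of the velocities `p = (ẋ, ẏ)`. -/
def constraintMap (hab : a ≤ b) (R : X × Y × Y → X) (x₀ : X) (y₀ : Y)
    (p : C(Icc a b, X) × C(Icc a b, Y)) : C(Icc a b, X) × X × Y :=
  (p.1 - superpose R (velocityCurve hab x₀ y₀ p), integralCLM hab p.1, integralCLM hab p.2)

/-- The linearization of `constraintMap`, where `A` is the derivative of `R` along the curve. -/
def constraintDeriv (hab : a ≤ b) (A : C(Icc a b, X × Y × Y →L[ℝ] X)) :
    C(Icc a b, X) × C(Icc a b, Y) →L[ℝ] C(Icc a b, X) × X × Y :=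
  (.fst ℝ _ _ - pointwiseApply A ∘L velocityLift hab).prod
    ((integralCLM hab ∘L .fst ℝ _ _).prod (integralCLM hab ∘L .snd ℝ _ _))

variable {R : X × Y × Y → X} {L : X × Y × Y → ℝ} {Ω : Set (X × Y × Y)} {x : ℝ → X} {y v : ℝ → Y}
  {x₀ : X} {y₀ : Y} {p : C(Icc a b, X) × C(Icc a b, Y)}

theorem hasStrictFDerivAt_superpose_velocityCurve {F : Type*} [NormedAddCommGroup F]
    [NormedSpace ℝ F] (hab : a ≤ b) (hΩ : IsOpen Ω) {f : X × Y × Y → F} (hf : ContDiffOn ℝ 1 f Ω)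
    (hp : ∀ t, velocityCurve hab x₀ y₀ p t ∈ Ω) {A : C(Icc a b, X × Y × Y →L[ℝ] F)}
    (hA : ∀ t, A t = fderiv ℝ f (velocityCurve hab x₀ y₀ p t)) :
    HasStrictFDerivAt (fun p => superpose f (velocityCurve hab x₀ y₀ p))
      (pointwiseApply A ∘L velocityLift hab) p :=
  HasStrictFDerivAt.comp (f := velocityCurve hab x₀ y₀) p (hasStrictFDerivAt_superpose hΩ hf hp hA)
    (hasStrictFDerivAt_velocityCurve hab x₀ y₀ p)

theorem hasStrictFDerivAt_constraintMap (hab : a ≤ b) (hΩ : IsOpen Ω) (hR : ContDiffOn ℝ 1 R Ω)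
    (hp : ∀ t, velocityCurve hab x₀ y₀ p t ∈ Ω) {A : C(Icc a b, X × Y × Y →L[ℝ] X)}
    (hA : ∀ t, A t = fderiv ℝ R (velocityCurve hab x₀ y₀ p t)) :
    HasStrictFDerivAt (constraintMap hab R x₀ y₀) (constraintDeriv hab A) p :=
  (hasStrictFDerivAt_fst.sub (hasStrictFDerivAt_superpose_velocityCurve hab hΩ hR hp hA)).prodMk
    (((integralCLM (E := X) hab).hasStrictFDerivAt.comp p hasStrictFDerivAt_fst).prodMk
      ((integralCLM (E := Y) hab).hasStrictFDerivAt.comp p hasStrictFDerivAt_snd))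

theorem isTrajectory_of_velocityCurve [CompleteSpace X] [CompleteSpace Y] (hab : a ≤ b)
    (hp : ∀ t, p.1 t = R (velocityCurve hab x₀ y₀ p t)) :
    IsTrajectory a b R (fun t => x₀ + ∫ s in a..t, IccExtend hab p.1 s)
      (fun t => y₀ + ∫ s in a..t, IccExtend hab p.2 s) (IccExtend hab p.2) where
  continuousOn_velocity := p.2.continuous.Icc_extend'.continuousOn
  base t ht := by
    rw [IccExtend_of_mem hab _ ht]
    exact ((hasDerivWithinAt_integral_IccExtend hab p.1 ⟨t, ht⟩).const_add x₀).congr_deriv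
      ((hp ⟨t, ht⟩).trans (congrArg R (velocityCurve_apply hab x₀ y₀ p ⟨t, ht⟩)))
  fibre t ht := by
    rw [IccExtend_of_mem hab _ ht]
    exact (hasDerivWithinAt_integral_IccExtend hab p.2 ⟨t, ht⟩).const_add y₀

theorem IsTrajectory.velocityCurve_eq [CompleteSpace X] [CompleteSpace Y] (hab : a ≤ b)
    (h : IsTrajectory a b R x y v) (hw : ContinuousOn (fun t => R (x t, y t, v t)) (Icc a b))
    (t : Icc a b) :
    velocityCurve hab (x a) (y a) (restrictIcc hw, restrictIcc h.continuousOn_velocity) t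
      = (x t, y t, v t) := by
  simp [velocityCurve, velocityLift_restrictIcc hab hw h.continuousOn_velocity h.base h.fibre]

theorem IsTrajectory.velocity_and_endpoints_eq_of_constraintMap_eq [CompleteSpace X]
    [CompleteSpace Y] (hab : a ≤ b) (h : IsTrajectory a b R x y v) (hR : ContinuousOn R Ω)
    (hw : ContinuousOn (fun t => R (x t, y t, v t)) (Icc a b))
    (hΩc : ∀ t ∈ Icc a b, (x t, y t, v t) ∈ Ω)
    (hp : ∀ t, velocityCurve hab (x a) (y a) p t ∈ Ω)
    (heq : constraintMap hab R (x a) (y a) p = constraintMap hab R (x a) (y a)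
      (restrictIcc hw, restrictIcc h.continuousOn_velocity)) :
    (∀ t, p.1 t = R (velocityCurve hab (x a) (y a) p t)) ∧
      x a + integralCLM hab p.1 = x b ∧ y a + integralCLM hab p.2 = y b := by
  have hcurve := h.velocityCurve_eq hab hw
  simp only [constraintMap, Prod.mk.injEq] at heq
  obtain ⟨hvel, hx, hy⟩ := heq
  refine ⟨fun t => ?_, ?_, ?_⟩
  · have ht := DFunLike.congr_fun hvel t
    rw [ContinuousMap.sub_apply, ContinuousMap.sub_apply, superpose_apply hR hp,
      superpose_apply hR fun t => (hcurve t).symm ▸ hΩc t t.2, hcurve, restrictIcc_apply, sub_self]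
      at ht
    exact sub_eq_zero.1 ht
  · rw [hx, integralCLM_apply_congr hab (f := fun t => R (x t, y t, v t)) (restrictIcc_apply hw),
      integral_eq_sub_of_hasDerivWithinAt_Icc h.base hw (right_mem_Icc.2 hab), add_sub_cancel]
  · rw [hy, integralCLM_apply_congr hab (restrictIcc_apply h.continuousOn_velocity),
      integral_eq_sub_of_hasDerivWithinAt_Icc h.fibre h.continuousOn_velocity
        (right_mem_Icc.2 hab), add_sub_cancel]

theorem IsWeakLocalMin.isLocalMinOn [CompleteSpace X] [CompleteSpace Y] (hab : a ≤ b)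
    (h : IsWeakLocalMin a b L R x y v) (hΩ : IsOpen Ω) (hL : ContinuousOn L Ω)
    (hR : ContinuousOn R Ω) (hw : ContinuousOn (fun t => R (x t, y t, v t)) (Icc a b))
    (hΩc : ∀ t ∈ Icc a b, (x t, y t, v t) ∈ Ω) :
    let p₀ := (restrictIcc hw, restrictIcc h.1.continuousOn_velocity)
    IsLocalMinOn (fun p => integralCLM hab (superpose L (velocityCurve hab (x a) (y a) p)))
      {p | constraintMap hab R (x a) (y a) p = constraintMap hab R (x a) (y a) p₀} p₀ := by
  intro p₀
  obtain ⟨htraj, δ, hδ, hmin⟩ := h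
  have hcurve := htraj.velocityCurve_eq hab hw
  have hcont := (hasStrictFDerivAt_velocityCurve hab (x a) (y a) p₀).continuousAt
  have hmem : ∀ᶠ p in 𝓝 p₀, MapsTo (velocityCurve hab (x a) (y a) p) univ Ω :=
    hcont.eventually (ContinuousMap.eventually_mapsTo isCompact_univ hΩ fun t _ =>
      (hcurve t).symm ▸ hΩc t t.2)
  filter_upwards [mem_nhdsWithin_of_mem_nhds hmem,
    mem_nhdsWithin_of_mem_nhds (hcont (Metric.ball_mem_nhds _ hδ)), self_mem_nhdsWithin]
    with p hpΩ hpδ hpc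
  replace hpΩ (t : Icc a b) : velocityCurve hab (x a) (y a) p t ∈ Ω := hpΩ (mem_univ t)
  obtain ⟨hvel, hx, hy⟩ :=
    htraj.velocity_and_endpoints_eq_of_constraintMap_eq hab hR hw hΩc hpΩ hpc
  rw [integralCLM_apply_congr hab (f := fun t => L (x t, y t, v t)) fun t => ?_,
    integralCLM_apply_congr hab (f := fun t => L (x a + ∫ s in a..t, IccExtend hab p.1 s,
      y a + ∫ s in a..t, IccExtend hab p.2 s, IccExtend hab p.2 t)) fun t => ?_]
  · refine hmin _ _ _ (isTrajectory_of_velocityCurve hab hvel) (by simp) (by simp) hx hy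
      fun t ht => ?_
    have hdist := (ContinuousMap.dist_apply_le_dist (⟨t, ht⟩ : Icc a b)).trans_lt hpδ
    rw [hcurve, velocityCurve_apply] at hdist
    rwa [IccExtend_of_mem hab _ ht]
  · rw [superpose_apply hL hpΩ, velocityCurve_apply, IccExtend_val]
    rfl
  · rw [superpose_apply hL fun t => (hcurve t).symm ▸ hΩc t t.2, hcurve]

/-- `Λ` is a Lagrange multiplier, with coefficient `μ` of the objective, for the linear functional
`∫ AL(x, y, ẏ)` under the linear constraints `ẋ - AR(x, y, ẏ) = 0`, `∫ ẋ = 0`, `∫ ẏ = 0`. -/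
def IsMultiplier (hab : a ≤ b) (AL : C(Icc a b, X × Y × Y →L[ℝ] ℝ))
    (AR : C(Icc a b, X × Y × Y →L[ℝ] X)) (μ : ℝ)
    (Λ : Module.Dual ℝ (C(Icc a b, X) × X × Y)) : Prop :=
  ∀ p, Λ (constraintDeriv hab AR p)
    + μ * integralCLM hab (pointwiseApply AL (velocityLift hab p)) = 0

theorem exists_normalized_multiplier {E F : Type*} [AddCommGroup E] [Module ℝ E]
    {G : F → E} {J : F → ℝ} {Λ : Module.Dual ℝ E} {μ : ℝ} (hne : (Λ, μ) ≠ 0)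
    (h : ∀ p, Λ (G p) + μ * J p = 0) :
    ∃ (Λ' : Module.Dual ℝ E) (μ' : ℝ), (μ' = 1 ∨ μ' = 0 ∧ Λ' ≠ 0) ∧
      ∀ p, Λ' (G p) + μ' * J p = 0 := by
  rcases eq_or_ne μ 0 with rfl | hμ
  · exact ⟨Λ, 0, .inr ⟨rfl, fun hΛ => hne (by rw [hΛ]; rfl)⟩, h⟩
  · refine ⟨μ⁻¹ • Λ, 1, .inl rfl, fun p => ?_⟩
    have hp := congrArg (μ⁻¹ * ·) (h p)
    simpa [mul_add, hμ] using hp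

theorem IsWeakLocalMin.exists_isMultiplier [CompleteSpace X] [CompleteSpace Y] (hab : a ≤ b)
    (h : IsWeakLocalMin a b L R x y v) (hΩ : IsOpen Ω) (hL : ContDiffOn ℝ 1 L Ω)
    (hR : ContDiffOn ℝ 1 R Ω) (hΩc : ∀ t ∈ Icc a b, (x t, y t, v t) ∈ Ω)
    {AL : C(Icc a b, X × Y × Y →L[ℝ] ℝ)} (hAL : ∀ t, AL t = fderiv ℝ L (x t, y t, v t))
    {AR : C(Icc a b, X × Y × Y →L[ℝ] X)} (hAR : ∀ t, AR t = fderiv ℝ R (x t, y t, v t)) :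
    ∃ Λ μ, (μ = 1 ∨ μ = 0 ∧ Λ ≠ 0) ∧ IsMultiplier hab AL AR μ Λ := by
  have hw : ContinuousOn (fun t => R (x t, y t, v t)) (Icc a b) :=
    hR.continuousOn.comp h.1.continuousOn hΩc
  have hcurve := h.1.velocityCurve_eq hab hw
  have hcurveΩ := fun t : Icc a b => (hcurve t).symm ▸ hΩc t t.2
  have hG := hasStrictFDerivAt_constraintMap hab hΩ hR hcurveΩ fun t =>
    (hAR t).trans (congrArg _ (hcurve t).symm)
  have hJ := (integralCLM (E := ℝ) hab).hasStrictFDerivAt.comp _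
    (hasStrictFDerivAt_superpose_velocityCurve hab hΩ hL hcurveΩ fun t =>
      (hAL t).trans (congrArg _ (hcurve t).symm))
  have hextr : IsLocalExtrOn _ _ _ :=
    .inl (h.isLocalMinOn hab hΩ hL.continuousOn hR.continuousOn hw hΩc)
  obtain ⟨Λ, μ, hne, hΛ⟩ := hextr.exists_linear_map_of_hasStrictFDerivAt hG hJ
  exact exists_normalized_multiplier hne hΛ

variable {μ : ℝ} {Λ : Module.Dual ℝ (C(Icc a b, X) × X × Y)}
  {AL : C(Icc a b, X × Y × Y →L[ℝ] ℝ)} {AR : C(Icc a b, X × Y × Y →L[ℝ] X)}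

theorem exists_adjoint_solution (hab : a ≤ b) (AL : C(Icc a b, X →L[ℝ] ℝ))
    (AR : C(Icc a b, X →L[ℝ] X)) (ℓ : X →L[ℝ] ℝ) :
    ∃ lam : ℝ → X →L[ℝ] ℝ, lam b = ℓ ∧
      ∀ t : Icc a b, HasDerivWithinAt lam (AL t - lam t ∘L AR t) (Icc a b) t := by
  let A (t : ℝ) : (X →L[ℝ] ℝ) →L[ℝ] X →L[ℝ] ℝ :=
    -(ContinuousLinearMap.compL ℝ X X ℝ).flip (IccExtend hab AR t)
  have hA : Continuous A :=
    ((ContinuousLinearMap.compL ℝ X X ℝ).flip.continuous.comp AR.continuous.Icc_extend').neg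
  obtain ⟨lam, hlamb, hlam⟩ := exists_linear_ode_solution_of_terminal hab hA.continuousOn
    (AL.continuous.Icc_extend' (h := hab)).continuousOn ℓ
  refine ⟨lam, hlamb, fun t => (hlam t t.2).congr_deriv ?_⟩
  simp [A, neg_add_eq_sub]

theorem integral_adjoint_apply [CompleteSpace X] {hab : a ≤ b} {lam : ℝ → X →L[ℝ] ℝ}
    {AL : C(Icc a b, X →L[ℝ] ℝ)} {AR : C(Icc a b, X →L[ℝ] X)}
    (hlam : ∀ t : Icc a b, HasDerivWithinAt lam (AL t - lam t ∘L AR t) (Icc a b) t)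
    {f w : C(Icc a b, X)} (hw : w = f + volterra hab AR w) :
    ∫ t in a..b, lam t (IccExtend hab f t)
      = lam b (integralCLM hab w) - integralCLM hab (pointwiseApply AL (primitive hab w)) := by
  have hlamc : ContinuousOn lam (Icc a b) := fun t ht => (hlam ⟨t, ht⟩).continuousWithinAt
  have hALc : Continuous (IccExtend hab (pointwiseApply AL (primitive hab w))) :=
    (pointwiseApply AL (primitive hab w)).continuous.Icc_extend'
  have hfc : ContinuousOn (fun t => lam t (IccExtend hab f t)) (Icc a b) :=
    hlamc.clm_apply f.continuous.Icc_extend'.continuousOn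
  have hderiv : ∀ t ∈ Icc a b, HasDerivWithinAt (fun t => lam t (∫ s in a..t, IccExtend hab w s))
      (IccExtend hab (pointwiseApply AL (primitive hab w)) t + lam t (IccExtend hab f t))
      (Icc a b) t := fun t ht => by
    refine ((hlam ⟨t, ht⟩).clm_apply
      (hasDerivWithinAt_integral_IccExtend hab w ⟨t, ht⟩)).congr_deriv ?_
    have hwt : w ⟨t, ht⟩ = f ⟨t, ht⟩ + AR ⟨t, ht⟩ (∫ s in a..t, IccExtend hab w s) :=
      DFunLike.congr_fun hw ⟨t, ht⟩
    simp [IccExtend_of_mem hab _ ht, hwt, primitive_apply]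
  have hint := integral_eq_sub_of_hasDerivWithinAt_Icc hderiv (hALc.continuousOn.add hfc)
    (right_mem_Icc.2 hab)
  rw [intervalIntegral.integral_add (hALc.intervalIntegrable a b)
    (hfc.intervalIntegrable_of_Icc hab), intervalIntegral.integral_same, map_zero, sub_zero] at hint
  exact eq_sub_of_add_eq' hint

theorem IsMultiplier.exists_adjoint [FiniteDimensional ℝ X] {hab : a ≤ b}
    (h : IsMultiplier hab AL AR μ Λ) :
    ∃ lam : ℝ → X →L[ℝ] ℝ, ContinuousOn lam (Icc a b) ∧
      (∀ f, Λ (f, 0, 0) = ∫ t in a..b, lam t (IccExtend hab f t)) ∧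
      ∀ e, Λ (0, e, 0) = -lam b e := by
  have : CompleteSpace X := FiniteDimensional.complete ℝ X
  let inl : X →L[ℝ] X × Y × Y := .inl ℝ X (Y × Y)
  let ALx : C(Icc a b, X →L[ℝ] ℝ) := ⟨fun t => AL t ∘L inl, by fun_prop⟩
  let ARx : C(Icc a b, X →L[ℝ] X) := ⟨fun t => AR t ∘L inl, by fun_prop⟩
  let Λend : X →ₗ[ℝ] ℝ := Λ ∘ₗ .inr ℝ _ _ ∘ₗ .inl ℝ X Y
  obtain ⟨lam, hlamb, hlam⟩ :=
    exists_adjoint_solution hab (μ • ALx) ARx (-Λend.toContinuousLinearMap)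
  have hΛend (e : X) : Λ (0, e, 0) = -lam b e := by simp [hlamb, Λend]
  refine ⟨lam, fun t ht => (hlam ⟨t, ht⟩).continuousWithinAt, fun f => ?_, hΛend⟩
  obtain ⟨w, hw⟩ := exists_eq_add_volterra hab ARx f
  have hlift (t : Icc a b) : velocityLift hab (w, (0 : C(Icc a b, Y))) t
      = inl (primitive hab w t) := by simp [velocityLift_apply, inl]
  have hG : constraintDeriv hab AR (w, (0 : C(Icc a b, Y))) = (f, integralCLM hab w, 0) := by
    have hf : f = w - volterra hab ARx w := eq_sub_of_add_eq hw.symm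
    refine Prod.ext (ContinuousMap.ext fun t => ?_)
      (Prod.ext rfl (map_zero (integralCLM (E := Y) hab)))
    simp [constraintDeriv, hlift, hf, volterra, ARx]
  have hJ : μ * integralCLM hab (pointwiseApply AL (velocityLift hab (w, (0 : C(Icc a b, Y)))))
      = integralCLM hab (pointwiseApply (μ • ALx) (primitive hab w)) := by
    rw [← smul_eq_mul, ← map_smul]
    refine congrArg _ (ContinuousMap.ext fun t => ?_)
    simp [hlift, ALx]
  have hΛ := h (w, 0)
  have hsplit : (f, integralCLM hab w, (0 : Y)) = (f, 0, 0) + (0, integralCLM hab w, 0) := by simp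
  rw [hG, hJ, hsplit, map_add, hΛend] at hΛ
  rw [integral_adjoint_apply hlam hw]
  linarith

theorem velocityLift_deriv [CompleteSpace X] [CompleteSpace Y] (hab : a ≤ b) {δx : ℝ → X}
    {δy : ℝ → Y} (hδx : ContDiff ℝ 1 δx) (hδy : ContDiff ℝ 1 δy) (hxa : δx a = 0) (hya : δy a = 0)
    (t : Icc a b) :
    velocityLift hab (restrictIcc (hδx.continuous_deriv le_rfl).continuousOn,
      restrictIcc (hδy.continuous_deriv le_rfl).continuousOn) t = (δx t, δy t, deriv δy t) := by
  rw [velocityLift_restrictIcc hab _ _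
    (fun s _ => (hδx.differentiable one_ne_zero s).hasDerivAt.hasDerivWithinAt)
    (fun s _ => (hδy.differentiable one_ne_zero s).hasDerivAt.hasDerivWithinAt), hxa, hya,
    sub_zero, sub_zero]

theorem integralCLM_restrictIcc_deriv [CompleteSpace X] (hab : a ≤ b) {δ : ℝ → X}
    (hδ : ContDiff ℝ 1 δ) :
    integralCLM hab (restrictIcc (hδ.continuous_deriv le_rfl).continuousOn) = δ b - δ a := by
  have hδ' := (hδ.continuous_deriv le_rfl).continuousOn (s := Icc a b)
  rw [integralCLM_apply_congr hab (restrictIcc_apply hδ'),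
    integral_eq_sub_of_hasDerivWithinAt_Icc (fun t _ =>
      (hδ.differentiable one_ne_zero t).hasDerivAt.hasDerivWithinAt) hδ' (right_mem_Icc.2 hab)]

theorem IsMultiplier.integral_variation_eq_zero [CompleteSpace X] [CompleteSpace Y] {hab : a ≤ b}
    {aL : ℝ → X × Y × Y →L[ℝ] ℝ} {aR : ℝ → X × Y × Y →L[ℝ] X} {haL : ContinuousOn aL (Icc a b)}
    {haR : ContinuousOn aR (Icc a b)} (h : IsMultiplier hab (restrictIcc haL) (restrictIcc haR) μ Λ)
    {lam : ℝ → X →L[ℝ] ℝ} (hlamc : ContinuousOn lam (Icc a b))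
    (hlam : ∀ f, Λ (f, 0, 0) = ∫ t in a..b, lam t (IccExtend hab f t)) {δx : ℝ → X} {δy : ℝ → Y}
    (hδx : ContDiff ℝ 1 δx) (hδy : ContDiff ℝ 1 δy) (hxa : δx a = 0) (hxb : δx b = 0)
    (hya : δy a = 0) (hyb : δy b = 0) :
    ∫ t in a..b, (μ * aL t (δx t, δy t, deriv δy t)
      + lam t (deriv δx t - aR t (δx t, δy t, deriv δy t))) = 0 := by
  have hδ : Continuous fun t => (δx t, δy t, deriv δy t) :=
    hδx.continuous.prodMk (hδy.continuous.prodMk (hδy.continuous_deriv le_rfl))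
  have hf : ContinuousOn (fun t => deriv δx t - aR t (δx t, δy t, deriv δy t)) (Icc a b) :=
    (hδx.continuous_deriv le_rfl).continuousOn.sub (haR.clm_apply hδ.continuousOn)
  let p := (restrictIcc ((hδx.continuous_deriv le_rfl).continuousOn (s := Icc a b)),
    restrictIcc ((hδy.continuous_deriv le_rfl).continuousOn (s := Icc a b)))
  have hlift (t : Icc a b) : velocityLift hab p t = (δx t, δy t, deriv δy t) :=
    velocityLift_deriv hab hδx hδy hxa hya t
  have hG : constraintDeriv hab (restrictIcc haR) p = (restrictIcc hf, 0, 0) := by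
    refine Prod.ext (ContinuousMap.ext fun t => ?_) (Prod.ext ?_ ?_)
    · simp [constraintDeriv, hlift, p]
    · exact (integralCLM_restrictIcc_deriv hab hδx).trans (by rw [hxa, hxb, sub_zero])
    · exact (integralCLM_restrictIcc_deriv hab hδy).trans (by rw [hya, hyb, sub_zero])
  have hext : ∫ t in a..b, lam t (IccExtend hab (restrictIcc hf) t)
      = ∫ t in a..b, lam t (deriv δx t - aR t (δx t, δy t, deriv δy t)) :=
    intervalIntegral.integral_congr fun t ht => by
      rw [uIcc_of_le hab] at ht
      simp only [IccExtend_of_mem hab _ ht, restrictIcc_apply]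
  have hp := h p
  rw [hG, hlam, hext, integralCLM_apply_congr hab (f := fun t => aL t (δx t, δy t, deriv δy t))
    fun t => by simp [hlift]] at hp
  have hLc : ContinuousOn (fun t => μ * aL t (δx t, δy t, deriv δy t)) (Icc a b) :=
    continuousOn_const.mul (haL.clm_apply hδ.continuousOn)
  rw [intervalIntegral.integral_add (hLc.intervalIntegrable_of_Icc hab)
    ((hlamc.clm_apply hf).intervalIntegrable_of_Icc hab), intervalIntegral.integral_const_mul,
    add_comm, hp]

theorem IsMultiplier.eq_zero_of_adjoint_eq_zero [CompleteSpace Y] (hab : a < b)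
    (h : IsMultiplier hab.le AL AR 0 Λ) (hf : ∀ f, Λ (f, 0, 0) = 0)
    (hx : ∀ e, Λ (0, e, 0) = 0) : Λ = 0 := by
  have hsplit (c : C(Icc a b, X) × X × Y) : Λ c = Λ (0, 0, c.2.2) := by
    have hc : c = (c.1, 0, 0) + (0, c.2.1, 0) + (0, 0, c.2.2) := by simp
    rw [hc, map_add, map_add, hf, hx]
    simp
  refine LinearMap.ext fun c => ?_
  have hc := h (0, .const _ ((b - a)⁻¹ • c.2.2))
  have hint : integralCLM hab.le (.const _ ((b - a)⁻¹ • c.2.2)) = c.2.2 := by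
    rw [integralCLM_apply_congr hab.le (f := fun _ => (b - a)⁻¹ • c.2.2) fun _ => rfl,
      intervalIntegral.integral_const, smul_inv_smul₀ (sub_ne_zero.2 hab.ne')]
  rw [zero_mul, add_zero, hsplit] at hc
  rw [hsplit, ← hint]
  exact hc

theorem IsMultiplier.isStationary {P : Type*} [NormedAddCommGroup P] [NormedSpace ℝ P]
    [CompleteSpace X] [CompleteSpace Y] (hab : a ≤ b) (hΩ : IsOpen Ω) (hL : ContDiffOn ℝ 1 L Ω)
    (hR : ContDiffOn ℝ 1 R Ω) (hcurve : ContinuousOn (fun t => (x t, y t, v t)) (Icc a b))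
    (hΩc : ∀ t ∈ Icc a b, (x t, y t, v t) ∈ Ω)
    {haL : ContinuousOn (fun t => fderiv ℝ L (x t, y t, v t)) (Icc a b)}
    {haR : ContinuousOn (fun t => fderiv ℝ R (x t, y t, v t)) (Icc a b)}
    (h : IsMultiplier hab (restrictIcc haL) (restrictIcc haR) μ Λ) {B : P →L[ℝ] X →L[ℝ] ℝ}
    {p : ℝ → P} (hp : ContinuousOn p (Icc a b))
    (hΛ : ∀ f, Λ (f, 0, 0) = ∫ t in a..b, B (p t) (IccExtend hab f t)) :
    IsStationary a b (augmentedLagrangian μ L R B) (fun t => (x t, y t))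
      (fun t => (R (x t, y t, v t), v t)) p := by
  have hz : ContinuousOn (fun t => (x t, y t)) (Icc a b) := hcurve.fst.prodMk hcurve.snd.fst
  have hz' : ContinuousOn (fun t => (R (x t, y t, v t), v t)) (Icc a b) :=
    (hR.continuousOn.comp hcurve hΩc).prodMk hcurve.snd.snd
  refine (isStationary_iff_forall_integral_eq_zero hab (hΩ.preimage (by fun_prop))
    (contDiffOn_augmentedLagrangian hL hR μ B) (hz.prodMk (hz'.prodMk hp)) hΩc).2
    fun δz δp hδz _ hza hzb => ?_
  rw [← h.integral_variation_eq_zero (B.continuous.comp_continuousOn hp) hΛ hδz.fst hδz.snd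
    (congrArg Prod.fst hza) (congrArg Prod.fst hzb) (congrArg Prod.snd hza) (congrArg Prod.snd hzb)]
  refine intervalIntegral.integral_congr fun t ht => ?_
  rw [uIcc_of_le hab] at ht
  have hnhds := hΩ.mem_nhds (hΩc t ht)
  have hδ := (hδz.differentiable one_ne_zero t).hasDerivAt
  have hδ' : deriv δz t = (deriv (fun t => (δz t).1) t, deriv (fun t => (δz t).2) t) :=
    Prod.ext ((ContinuousLinearMap.fst ℝ X Y).hasFDerivAt.comp_hasDerivAt t hδ).deriv.symm
      ((ContinuousLinearMap.snd ℝ X Y).hasFDerivAt.comp_hasDerivAt t hδ).deriv.symm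
  simp only [hδ']
  refine (fderiv_augmentedLagrangian_apply μ B ((hL.contDiffAt hnhds).differentiableAt
    one_ne_zero) ((hR.contDiffAt hnhds).differentiableAt one_ne_zero) ..).trans ?_
  simp

theorem IsWeakLocalMin.exists_isStationary {P : Type*} [NormedAddCommGroup P] [NormedSpace ℝ P]
    [FiniteDimensional ℝ X] [CompleteSpace Y] (hab : a < b) (h : IsWeakLocalMin a b L R x y v)
    (hΩ : IsOpen Ω) (hL : ContDiffOn ℝ 1 L Ω) (hR : ContDiffOn ℝ 1 R Ω)
    (hΩc : ∀ t ∈ Icc a b, (x t, y t, v t) ∈ Ω) (B : P ≃L[ℝ] X →L[ℝ] ℝ) :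
    ∃ μ p, (μ = 1 ∨ μ = 0 ∧ ∃ t ∈ Icc a b, p t ≠ 0) ∧ ContinuousOn p (Icc a b) ∧
      IsStationary a b (augmentedLagrangian μ L R (B : P →L[ℝ] X →L[ℝ] ℝ)) (fun t => (x t, y t))
        (fun t => (R (x t, y t, v t), v t)) p := by
  have : CompleteSpace X := FiniteDimensional.complete ℝ X
  have hcurve := h.1.continuousOn
  have haL : ContinuousOn (fun t => fderiv ℝ L (x t, y t, v t)) (Icc a b) :=
    (hL.continuousOn_fderiv_of_isOpen hΩ le_rfl).comp hcurve hΩc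
  have haR : ContinuousOn (fun t => fderiv ℝ R (x t, y t, v t)) (Icc a b) :=
    (hR.continuousOn_fderiv_of_isOpen hΩ le_rfl).comp hcurve hΩc
  obtain ⟨Λ, μ, hμ, hΛ⟩ := h.exists_isMultiplier hab.le hΩ hL hR hΩc (restrictIcc_apply haL)
    (restrictIcc_apply haR)
  obtain ⟨lam, hlamc, hlam, hlamb⟩ := hΛ.exists_adjoint
  have hpc : ContinuousOn (fun t => B.symm (lam t)) (Icc a b) :=
    B.symm.continuous.comp_continuousOn hlamc
  refine ⟨μ, fun t => B.symm (lam t), hμ.imp_right fun hμ => ⟨hμ.1, ?_⟩, hpc, ?_⟩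
  · by_contra! hp
    have hlam0 : ∀ t ∈ Icc a b, lam t = 0 := fun t ht => by simpa using hp t ht
    obtain ⟨rfl, hne⟩ := hμ
    refine hne (hΛ.eq_zero_of_adjoint_eq_zero hab (fun f => (hlam f).trans ?_) fun e => ?_)
    · refine intervalIntegral.integral_zero_ae (.of_forall fun t ht => ?_)
      rw [uIoc_of_le hab.le] at ht
      simp [hlam0 t (Ioc_subset_Icc_self ht)]
    · simp [hlamb, hlam0 b (right_mem_Icc.2 hab.le)]
  · exact hΛ.isStationary hab.le hΩ hL hR hcurve hΩc hpc (by simpa using hlam)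

end Multipliers

section MatrixInverse

variable {ι : Type*} [Fintype ι] [DecidableEq ι] {N : WithTop ℕ∞}

theorem contDiff_matrix_det : ContDiff ℝ N fun A : ι → ι → ℝ => (Matrix.of A).det := by
  simp only [Matrix.det_apply, Matrix.of_apply]
  fun_prop

/- Cramer's rule makes the entries of the inverse rational functions of the entries. -/
theorem contDiffAt_matrix_inv {A : ι → ι → ℝ} (hA : IsUnit (Matrix.of A).det) (i j : ι) :
    ContDiffAt ℝ N (fun A : ι → ι → ℝ => (Matrix.of A)⁻¹ i j) A := by
  have hcramer : (fun A : ι → ι → ℝ => (Matrix.of A)⁻¹ i j) = fun A : ι → ι → ℝ =>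
      (Matrix.of A).det⁻¹ * (Matrix.of (Function.update A j (Pi.single i 1))).det := by
    funext A
    rw [Matrix.inv_def, Matrix.smul_apply, Matrix.adjugate_apply, Ring.inverse_eq_inv', smul_eq_mul]
    rfl
  have hupdate : ContDiff ℝ N fun A : ι → ι → ℝ => Function.update A j (Pi.single i 1) := by
    refine contDiff_pi.2 fun k => ?_
    by_cases hk : k = j
    · subst hk
      simpa only [Function.update_self] using contDiff_const
    · simp only [Function.update_of_ne hk]
      fun_prop
  rw [hcramer]
  exact (contDiff_matrix_det.contDiffAt.inv hA.ne_zero).mul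
    (contDiff_matrix_det.comp hupdate).contDiffAt

end MatrixInverse

section Chart

variable {E M : Type*} [NormedAddCommGroup E] [NormedSpace ℝ E] [TopologicalSpace M]
  [ChartedSpace E M] {φ : OpenPartialHomeomorph M E}

theorem hasDerivWithinAt_iff_hasMFDerivWithinAt_smulRight {f : ℝ → E} {η : E} {s : Set ℝ} {t : ℝ} :
    HasDerivWithinAt f η s t ↔
      HasMFDerivWithinAt 𝓘(ℝ, ℝ) 𝓘(ℝ, E) f s t ((1 : ℝ →L[ℝ] ℝ).smulRight η) := by
  have hη : ContinuousLinearMap.toSpanSingleton ℝ η = (1 : ℝ →L[ℝ] ℝ).smulRight η := by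
    ext; simp
  rw [hasDerivWithinAt_iff_hasFDerivWithinAt, hη]
  exact hasMFDerivWithinAt_iff_hasFDerivWithinAt.symm

theorem mdifferentiable_of_mem_maximalAtlas [IsManifold 𝓘(ℝ, E) 1 M]
    (hφ : φ ∈ IsManifold.maximalAtlas 𝓘(ℝ, E) 1 M) :
    φ.MDifferentiable 𝓘(ℝ, E) 𝓘(ℝ, E) :=
  ⟨(contMDiffOn_of_mem_maximalAtlas hφ).mdifferentiableOn one_ne_zero,
    (contMDiffOn_symm_of_mem_maximalAtlas hφ).mdifferentiableOn one_ne_zero⟩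

theorem hasMFDerivWithinAt_curve_iff [IsManifold 𝓘(ℝ, E) 1 M]
    (hφ : φ ∈ IsManifold.maximalAtlas 𝓘(ℝ, E) 1 M) {q : ℝ → M}
    {s : Set ℝ} (hq : ∀ t ∈ s, q t ∈ φ.source) {t : ℝ} (ht : t ∈ s)
    (ξ : TangentSpace 𝓘(ℝ, E) (q t)) :
    HasMFDerivWithinAt 𝓘(ℝ, ℝ) 𝓘(ℝ, E) q s t ((1 : ℝ →L[ℝ] ℝ).smulRight ξ) ↔
      HasDerivWithinAt (fun r => φ (q r))
        (show E from mfderiv 𝓘(ℝ, E) 𝓘(ℝ, E) φ (q t) ξ) s t := by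
  have hd := mdifferentiable_of_mem_maximalAtlas hφ
  have hφt := (hd.mdifferentiableAt (hq t ht)).hasMFDerivAt
  have hφt' := (hd.mdifferentiableAt_symm (φ.map_source (hq t ht))).hasMFDerivAt
  set η : E := mfderiv 𝓘(ℝ, E) 𝓘(ℝ, E) φ (q t) ξ
  have hη : mfderiv 𝓘(ℝ, E) 𝓘(ℝ, E) φ.symm (φ (q t)) η = ξ :=
    DFunLike.congr_fun (hd.symm_comp_deriv (hq t ht)) ξ
  change _ ↔ HasDerivWithinAt (fun r => φ (q r)) η s t
  rw [hasDerivWithinAt_iff_hasMFDerivWithinAt_smulRight]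
  constructor <;> intro h
  · refine (hφt.comp_hasMFDerivWithinAt t h).congr_mfderiv (ContinuousLinearMap.ext fun c => ?_)
    exact map_smul (mfderiv 𝓘(ℝ, E) 𝓘(ℝ, E) φ (q t)) (show ℝ from c) ξ
  · have hsymm : HasMFDerivWithinAt 𝓘(ℝ, ℝ) 𝓘(ℝ, E) q s t _ :=
      (hφt'.comp_hasMFDerivWithinAt (f := fun r => φ (q r)) t h).congr_of_eventuallyEq
        (Filter.eventually_of_mem self_mem_nhdsWithin fun r hr => (φ.left_inv (hq r hr)).symm)
        (φ.left_inv (hq t ht)).symm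
    refine HasMFDerivWithinAt.congr_mfderiv hsymm (ContinuousLinearMap.ext fun c => ?_)
    exact (map_smul (mfderiv 𝓘(ℝ, E) 𝓘(ℝ, E) φ.symm (φ (q t))) (show ℝ from c) η).trans
      (congrArg (fun w : E => (show ℝ from c) • w) hη)

theorem contMDiffOn_chart_symm_fst {k : WithTop ℕ∞}
    (hφ : φ ∈ IsManifold.maximalAtlas 𝓘(ℝ, E) k M)
    {F : Type*} [NormedAddCommGroup F] [NormedSpace ℝ F] :
    ContMDiffOn 𝓘(ℝ, E × F) 𝓘(ℝ, E) k (fun z : E × F => φ.symm z.1) {z | z.1 ∈ φ.target} :=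
  (contMDiffOn_symm_of_mem_maximalAtlas hφ).comp
    (contMDiffOn_iff_contDiffOn.2 contDiffOn_fst) fun _ hz => hz

theorem contDiffOn_chart_comp {k : WithTop ℕ∞} (hφ : φ ∈ IsManifold.maximalAtlas 𝓘(ℝ, E) k M)
    {q : ℝ → M} {s : Set ℝ} (hq : ContMDiffOn 𝓘(ℝ, ℝ) 𝓘(ℝ, E) k q s)
    (hs : ∀ t ∈ s, q t ∈ φ.source) : ContDiffOn ℝ k (fun t => φ (q t)) s :=
  contMDiffOn_iff_contDiffOn.1 ((contMDiffOn_of_mem_maximalAtlas hφ).comp hq hs)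

end Chart

section Pairing

/-- The pairing `(λ, w) ↦ λ_i w^i` of multipliers with coordinate velocities, as an isomorphism onto
the dual of `ℝⁿ`. -/
def pairing (n : ℕ) : (Fin n → ℝ) ≃L[ℝ] (EuclideanSpace ℝ (Fin n) →L[ℝ] ℝ) :=
  (((EuclideanSpace.basisFun (Fin n) ℝ).toBasis.constr ℝ).trans
    LinearMap.toContinuousLinearMap).toContinuousLinearEquiv

theorem pairing_apply {n : ℕ} (l : Fin n → ℝ) (w : EuclideanSpace ℝ (Fin n)) :
    pairing n l w = ∑ i, l i * w i := by
  simp [pairing, Module.Basis.constr_apply_fintype, mul_comm]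

theorem pairing_single {n : ℕ} (l : Fin n → ℝ) (i : Fin n) :
    pairing n l (EuclideanSpace.single i 1) = l i := by
  simp [pairing_apply]

theorem eq_zero_of_forall_pairing_eq_zero {n : ℕ} (w : EuclideanSpace ℝ (Fin n))
    (h : ∀ l, pairing n l w = 0) : w = 0 := by
  ext i
  simpa [pairing_apply, Pi.single_apply] using h (Pi.single i 1)

end Pairing

variable {n m : ℕ} {Q : Type*} [TopologicalSpace Q]
  [ChartedSpace (EuclideanSpace ℝ (Fin n)) Q] [IsManifold (𝓡 n) ∞ Q]
  {D : Q → Type*} [TopologicalSpace (TotalSpace (EuclideanSpace ℝ (Fin m)) D)]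
  [∀ x, AddCommGroup (D x)] [∀ x, Module ℝ (D x)] [∀ x, TopologicalSpace (D x)]
  [FiberBundle (EuclideanSpace ℝ (Fin m)) D] [VectorBundle ℝ (EuclideanSpace ℝ (Fin m)) D]
  [ContMDiffVectorBundle ∞ (EuclideanSpace ℝ (Fin m)) D (𝓡 n)]

namespace System

variable (S : System n m Q D)

section FibreCoordinates

theorem frame_repr_sum (x : Q) (y : Fin m → ℝ) (A : Fin m) :
    (S.frame x).repr (∑ B, y B • S.input B x) A = y A := by
  have hsum : ∑ B, y B • S.input B x = ∑ B, y B • S.frame x B := by simp [frame]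
  rw [hsum, Module.Basis.repr_sum_self]

theorem sum_coord_smul (v : TotalSpace (EuclideanSpace ℝ (Fin m)) D) :
    ∑ A, S.coord v A • S.input A v.proj = v.snd := by
  simpa [coord, frame] using (S.frame v.proj).sum_repr v.snd

theorem coord_point (x : Q) (y : Fin m → ℝ) : S.coord (S.point x y) = y :=
  funext fun A => S.frame_repr_sum x y A

theorem point_coord (v : TotalSpace (EuclideanSpace ℝ (Fin m)) D) :
    S.point v.proj (S.coord v) = v := by
  rw [point, S.sum_coord_smul]

/-- The linear map `y ↦ y^A Y_A(x)` read in the trivialization of `D` at `x₀`. -/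
def frameMap (x₀ x : Q) : (Fin m → ℝ) →L[ℝ] EuclideanSpace ℝ (Fin m) :=
  ∑ A, (ContinuousLinearMap.proj A : (Fin m → ℝ) →L[ℝ] ℝ).smulRight
    (trivializationAt (EuclideanSpace ℝ (Fin m)) D x₀ ⟨x, S.input A x⟩).2

variable {S} in
theorem frameMap_apply {x₀ x : Q}
    (hx : x ∈ (trivializationAt (EuclideanSpace ℝ (Fin m)) D x₀).baseSet) (y : Fin m → ℝ) :
    S.frameMap x₀ x y =
      (trivializationAt (EuclideanSpace ℝ (Fin m)) D x₀ (S.point x y)).2 := by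
  have hlin := congrFun
    ((trivializationAt (EuclideanSpace ℝ (Fin m)) D x₀).coe_linearMapAt_of_mem (R := ℝ) hx)
  simp only [frameMap, point, ← hlin, map_sum, map_smul, FunLike.coe_sum,
    Finset.sum_apply, ContinuousLinearMap.smulRight_apply, ContinuousLinearMap.proj_apply]

theorem contMDiffAt_frameMap (x₀ : Q) :
    ContMDiffAt (𝓡 n) 𝓘(ℝ, (Fin m → ℝ) →L[ℝ] EuclideanSpace ℝ (Fin m)) ∞
      (S.frameMap x₀) x₀ := by
  unfold frameMap
  refine contMDiffAt_finsetSum fun A _ => ?_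
  exact (ContinuousLinearMap.smulRightL ℝ (Fin m → ℝ) (EuclideanSpace ℝ (Fin m))
    (ContinuousLinearMap.proj A)).contMDiff.contMDiffAt.comp x₀
      ((contMDiffAt_section x₀).1 ((S.input A).contMDiff x₀))

theorem isInvertible_frameMap {x₀ x : Q}
    (hx : x ∈ (trivializationAt (EuclideanSpace ℝ (Fin m)) D x₀).baseSet) :
    (S.frameMap x₀ x).IsInvertible := by
  refine ⟨((S.frame x).equivFun.symm.trans ((trivializationAt (EuclideanSpace ℝ (Fin m)) D
    x₀).linearEquivAt ℝ x hx)).toContinuousLinearEquiv, ContinuousLinearMap.ext fun y => ?_⟩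
  have hpoint : S.point x y = ⟨x, (S.frame x).equivFun.symm y⟩ := by
    simp [Module.Basis.equivFun_symm_apply, point, frame]
  rw [frameMap_apply hx, hpoint]
  rfl

theorem contMDiff_point : ContMDiff ((𝓡 n).prod 𝓘(ℝ, Fin m → ℝ))
    ((𝓡 n).prod 𝓘(ℝ, EuclideanSpace ℝ (Fin m))) ∞
    (fun p : Q × (Fin m → ℝ) => S.point p.1 p.2) := by
  intro p₀
  have hmem : ∀ᶠ p : Q × (Fin m → ℝ) in 𝓝 p₀,
      p.1 ∈ (trivializationAt (EuclideanSpace ℝ (Fin m)) D p₀.1).baseSet :=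
    continuous_fst.continuousAt (Trivialization.open_baseSet _ |>.mem_nhds
      (mem_baseSet_trivializationAt _ _ _))
  have hframe : ContMDiffAt ((𝓡 n).prod 𝓘(ℝ, Fin m → ℝ)) 𝓘(ℝ, EuclideanSpace ℝ (Fin m)) ∞
      (fun p : Q × (Fin m → ℝ) => S.frameMap p₀.1 p.1 p.2) p₀ :=
    ((S.contMDiffAt_frameMap p₀.1).comp p₀ contMDiffAt_fst).clm_apply contMDiffAt_snd
  refine contMDiffAt_totalSpace.2 ⟨contMDiffAt_fst, hframe.congr_of_eventuallyEq ?_⟩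
  filter_upwards [hmem] with p hp using (frameMap_apply hp p.2).symm

theorem contMDiff_coord : ContMDiff ((𝓡 n).prod 𝓘(ℝ, EuclideanSpace ℝ (Fin m)))
    𝓘(ℝ, Fin m → ℝ) ∞ S.coord := by
  intro v₀
  have hx₀ : v₀.proj ∈ (trivializationAt (EuclideanSpace ℝ (Fin m)) D v₀.proj).baseSet :=
    mem_baseSet_trivializationAt _ _ _
  obtain ⟨hproj, hfib⟩ := contMDiffAt_totalSpace.1
    (contMDiffAt_id (I := (𝓡 n).prod 𝓘(ℝ, EuclideanSpace ℝ (Fin m))) (x := v₀) (n := ∞))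
  have hmem : ∀ᶠ v : TotalSpace (EuclideanSpace ℝ (Fin m)) D in 𝓝 v₀,
      v.proj ∈ (trivializationAt (EuclideanSpace ℝ (Fin m)) D v₀.proj).baseSet :=
    hproj.continuousAt ((Trivialization.open_baseSet _).mem_nhds hx₀)
  have hinv : ContMDiffAt ((𝓡 n).prod 𝓘(ℝ, EuclideanSpace ℝ (Fin m)))
      𝓘(ℝ, EuclideanSpace ℝ (Fin m) →L[ℝ] Fin m → ℝ) ∞
      (fun v => (S.frameMap v₀.proj v.proj).inverse) v₀ :=
    (S.isInvertible_frameMap hx₀).contDiffAt_map_inverse.contMDiffAt.comp v₀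
      ((S.contMDiffAt_frameMap v₀.proj).comp v₀ hproj)
  refine (hinv.clm_apply hfib).congr_of_eventuallyEq ?_
  filter_upwards [hmem] with v hv
  have hcoord := frameMap_apply (S := S) hv (S.coord v)
  rw [S.point_coord] at hcoord
  exact ((S.isInvertible_frameMap hv).inverse_apply_eq.2 hcoord.symm).symm

end FibreCoordinates

section EliminatedControl

theorem contMDiff_lieDeriv (X : Cₛ^∞⟮𝓡 n; EuclideanSpace ℝ (Fin m), D⟯) {f : Q → ℝ}
    (hf : ContMDiff (𝓡 n) 𝓘(ℝ, ℝ) ∞ f) : ContMDiff (𝓡 n) 𝓘(ℝ, ℝ) ∞ (S.lieDeriv X f) :=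
  (contMDiff_snd_tangentBundle_modelSpace ℝ 𝓘(ℝ, ℝ)).comp
    ((hf.contMDiff_tangentMap (m := ∞) (by simp)).comp (S.anchor_smooth.comp X.contMDiff))

theorem contMDiff_gram_inv (A B : Fin m) :
    ContMDiff (𝓡 n) 𝓘(ℝ, ℝ) ∞ (fun x => (S.gram x)⁻¹ A B) := by
  intro x
  have hinv : ContMDiffAt 𝓘(ℝ, Fin m → Fin m → ℝ) 𝓘(ℝ, ℝ) ∞
      (fun N : Fin m → Fin m → ℝ => (Matrix.of N)⁻¹ A B) (S.gram x) :=
    (contDiffAt_matrix_inv (S.gram_isUnit x) A B).contMDiffAt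
  have hgram : ContMDiffAt (𝓡 n) 𝓘(ℝ, Fin m → Fin m → ℝ) ∞ (fun x A B => S.gram x A B) x :=
    contMDiffAt_pi_space.2 fun A => contMDiffAt_pi_space.2 fun B =>
      S.metric_smooth (S.input A) (S.input B) x
  exact hinv.comp x hgram

theorem contMDiff_koszul (X Y Z : Cₛ^∞⟮𝓡 n; EuclideanSpace ℝ (Fin m), D⟯) :
    ContMDiff (𝓡 n) 𝓘(ℝ, ℝ) ∞ (S.koszul X Y Z) :=
  (((((S.contMDiff_lieDeriv X (S.metric_smooth Y Z)).add
    (S.contMDiff_lieDeriv Y (S.metric_smooth X Z))).sub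
    (S.contMDiff_lieDeriv Z (S.metric_smooth X Y))).add
    (S.metric_smooth X (S.bracket Z Y))).add (S.metric_smooth Y (S.bracket Z X))).sub
    (S.metric_smooth Z (S.bracket Y X))

theorem christoffel_eq_sum (A B C : Fin m) (x : Q) :
    S.christoffel A B C x = (1 / 2 : ℝ) *
      ∑ E, (S.gram x)⁻¹ C E * S.koszul (S.input A) (S.input B) (S.input E) x :=
  S.frame_repr_sum x _ C

theorem repr_gradV_eq_sum (C : Fin m) (x : Q) :
    (S.frame x).repr (S.gradV x) C = ∑ E, (S.gram x)⁻¹ C E * S.lieDeriv (S.input E) S.V x :=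
  S.frame_repr_sum x _ C

theorem contMDiff_christoffel (A B C : Fin m) :
    ContMDiff (𝓡 n) 𝓘(ℝ, ℝ) ∞ (S.christoffel A B C) := by
  rw [funext (S.christoffel_eq_sum A B C)]
  exact contMDiff_const.mul (contMDiff_finsetSum fun E _ =>
    (S.contMDiff_gram_inv C E).mul (S.contMDiff_koszul _ _ _))

theorem contMDiff_repr_gradV (C : Fin m) :
    ContMDiff (𝓡 n) 𝓘(ℝ, ℝ) ∞ (fun x => (S.frame x).repr (S.gradV x) C) := by
  rw [funext (S.repr_gradV_eq_sum C)]
  exact contMDiff_finsetSum fun E _ =>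
    (S.contMDiff_gram_inv C E).mul (S.contMDiff_lieDeriv _ S.V.contMDiff)

theorem contMDiff_elimControl :
    ContMDiff ((𝓡 n).prod 𝓘(ℝ, (Fin m → ℝ) × (Fin m → ℝ))) 𝓘(ℝ, Fin m → ℝ) ∞
      (fun p : Q × (Fin m → ℝ) × (Fin m → ℝ) => S.elimControl p.1 p.2.1 p.2.2) := by
  have hy (A : Fin m) : ContMDiff ((𝓡 n).prod 𝓘(ℝ, (Fin m → ℝ) × (Fin m → ℝ))) 𝓘(ℝ, ℝ) ∞
      (fun p : Q × (Fin m → ℝ) × (Fin m → ℝ) => p.2.1 A) :=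
    (by fun_prop : ContDiff ℝ ∞ fun q : (Fin m → ℝ) × (Fin m → ℝ) => q.1 A).contMDiff.comp
      contMDiff_snd
  have hv (A : Fin m) : ContMDiff ((𝓡 n).prod 𝓘(ℝ, (Fin m → ℝ) × (Fin m → ℝ))) 𝓘(ℝ, ℝ) ∞
      (fun p : Q × (Fin m → ℝ) × (Fin m → ℝ) => p.2.2 A) :=
    (by fun_prop : ContDiff ℝ ∞ fun q : (Fin m → ℝ) × (Fin m → ℝ) => q.2 A).contMDiff.comp
      contMDiff_snd
  refine contMDiff_pi_space.2 fun C => ?_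
  refine ((hv C).add (contMDiff_finsetSum fun A _ => contMDiff_finsetSum fun B _ => ?_)).add
    ((S.contMDiff_repr_gradV C).comp contMDiff_fst)
  exact (((S.contMDiff_christoffel A B C).comp contMDiff_fst).mul (hy A)).mul (hy B)

end EliminatedControl

section Chart

variable {φ : OpenPartialHomeomorph Q (EuclideanSpace ℝ (Fin n))}

/-- The right-hand side `ρ^i_A(q) y^A` of the admissibility equation in the chart `φ`, as a function
of `(q, y, ẏ)` so that it can serve as the constraint of a variational problem; it does not depend
on `ẏ`. -/
def velocityField (φ : OpenPartialHomeomorph Q (EuclideanSpace ℝ (Fin n)))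
    (c : EuclideanSpace ℝ (Fin n) × (Fin m → ℝ) × (Fin m → ℝ)) : EuclideanSpace ℝ (Fin n) :=
  WithLp.toLp 2 fun i => ∑ A, S.anchorCoeff φ A i c.1 * c.2.1 A

theorem contDiffOn_anchorCoeff (hφ : φ ∈ IsManifold.maximalAtlas (𝓡 n) ∞ Q) (A : Fin m)
    (i : Fin n) : ContDiffOn ℝ ∞ (S.anchorCoeff φ A i) φ.target := by
  have hanchor : ContMDiffOn (𝓡 n) (𝓡 n).tangent ∞ (fun x =>
      (⟨φ.symm x, S.anchor (φ.symm x) (S.input A (φ.symm x))⟩ : TangentBundle (𝓡 n) Q))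
      φ.target :=
    (S.anchor_smooth.comp (S.input A).contMDiff).comp_contMDiffOn
      (contMDiffOn_symm_of_mem_maximalAtlas hφ)
  have hchart := (contMDiffOn_of_mem_maximalAtlas hφ).contMDiffOn_tangentMapWithin (m := ∞)
    (by simp) φ.open_source.uniqueMDiffOn
  have hvector : ContMDiffOn (𝓡 n) 𝓘(ℝ, EuclideanSpace ℝ (Fin n)) ∞ (fun x =>
      (tangentMapWithin (𝓡 n) (𝓡 n) φ φ.source
        (⟨φ.symm x, S.anchor (φ.symm x) (S.input A (φ.symm x))⟩ : TangentBundle (𝓡 n) Q)).2)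
      φ.target :=
    (contMDiff_snd_tangentBundle_modelSpace (EuclideanSpace ℝ (Fin n)) (𝓡 n)).comp_contMDiffOn
      (hchart.comp hanchor fun x hx => φ.map_target hx)
  refine ((EuclideanSpace.proj (𝕜 := ℝ) i).contDiff.comp_contDiffOn
    (contMDiffOn_iff_contDiffOn.1 hvector)).congr fun x hx => ?_
  have hderiv : mfderivWithin (𝓡 n) (𝓡 n) φ φ.source (φ.symm x) =
      mfderiv (𝓡 n) (𝓡 n) φ (φ.symm x) :=
    mfderivWithin_of_isOpen φ.open_source (φ.map_target hx)
  change _ = (show EuclideanSpace ℝ (Fin n) from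
    mfderivWithin (𝓡 n) (𝓡 n) φ φ.source (φ.symm x) _) i
  rw [hderiv]
  rfl

theorem contDiffOn_velocityField (hφ : φ ∈ IsManifold.maximalAtlas (𝓡 n) ∞ Q) :
    ContDiffOn ℝ ∞ (S.velocityField φ) {c | c.1 ∈ φ.target} := by
  refine (contDiffOn_piLp 2).2 fun i => ?_
  simp only [velocityField]
  refine ContDiffOn.sum (𝕜 := ℝ) (f := fun A (c : EuclideanSpace ℝ (Fin n) × (Fin m → ℝ) ×
    (Fin m → ℝ)) => S.anchorCoeff φ A i c.1 * c.2.1 A) fun A _ => ?_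
  exact ((S.contDiffOn_anchorCoeff hφ A i).comp contDiffOn_fst fun c hc => hc).mul (by fun_prop)

theorem anchorCoeff_chart (A : Fin m) (i : Fin n) {q : Q} (hq : q ∈ φ.source) :
    S.anchorCoeff φ A i (φ q) = (show EuclideanSpace ℝ (Fin n) from
      mfderiv (𝓡 n) (𝓡 n) φ q (S.anchor q (S.input A q))) i := by
  rw [anchorCoeff, φ.left_inv hq]

theorem mfderiv_chart_anchor (v : TotalSpace (EuclideanSpace ℝ (Fin m)) D)
    (hv : v.proj ∈ φ.source) (w : Fin m → ℝ) :
    (show EuclideanSpace ℝ (Fin n) from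
      mfderiv (𝓡 n) (𝓡 n) φ v.proj (S.anchor v.proj v.snd))
      = S.velocityField φ (φ v.proj, S.coord v, w) := by
  have hlin : (show EuclideanSpace ℝ (Fin n) from
      mfderiv (𝓡 n) (𝓡 n) φ v.proj (S.anchor v.proj v.snd))
      = ∑ A, S.coord v A • (show EuclideanSpace ℝ (Fin n) from
        mfderiv (𝓡 n) (𝓡 n) φ v.proj (S.anchor v.proj (S.input A v.proj))) := by
    have := congrArg (fun w => mfderiv (𝓡 n) (𝓡 n) φ v.proj (S.anchor v.proj w))
      (S.sum_coord_smul v)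
    simp only [map_sum, map_smul] at this
    exact this.symm
  rw [hlin]
  ext i
  simp only [WithLp.ofLp_sum, Finset.sum_apply, velocityField]
  refine Finset.sum_congr rfl fun A _ => ?_
  rw [S.anchorCoeff_chart A i hv, mul_comm]
  rfl

theorem isAdmissible_iff (hφ : φ ∈ IsManifold.maximalAtlas (𝓡 n) ∞ Q) {T : ℝ}
    {γ : ℝ → TotalSpace (EuclideanSpace ℝ (Fin m)) D} (w : ℝ → Fin m → ℝ)
    (hγ : ∀ t ∈ Icc 0 T, (γ t).proj ∈ φ.source) :
    S.IsAdmissible T γ ↔ ∀ t ∈ Icc 0 T, HasDerivWithinAt (basePath φ γ)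
      (S.velocityField φ (basePath φ γ t, S.coord (γ t), w t)) (Icc 0 T) t := by
  have : IsManifold (𝓡 n) 1 Q := .of_le (n := ∞) (by simp)
  refine forall₂_congr fun t ht => ?_
  rw [hasMFDerivWithinAt_curve_iff (IsManifold.maximalAtlas_subset_of_le (by simp) hφ) hγ ht,
    S.mfderiv_chart_anchor _ (hγ t ht) (w t)]
  rfl

end Chart

section Curves

variable {φ : OpenPartialHomeomorph Q (EuclideanSpace ℝ (Fin n))} {T : ℝ}
  {γ : ℝ → TotalSpace (EuclideanSpace ℝ (Fin m)) D}

theorem contDiffOn_coord (hγ : IsC1 (n := n) T γ) :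
    ContDiffOn ℝ 1 (fun t => S.coord (γ t)) (Icc 0 T) :=
  contMDiffOn_iff_contDiffOn.1 ((S.contMDiff_coord.of_le (by simp)).comp_contMDiffOn hγ)

theorem isC1_point (hφ : φ ∈ IsManifold.maximalAtlas (𝓡 n) ∞ Q) {x : ℝ → EuclideanSpace ℝ (Fin n)}
    {y : ℝ → Fin m → ℝ} (hx : ContDiffOn ℝ 1 x (Icc 0 T)) (hy : ContDiffOn ℝ 1 y (Icc 0 T))
    (hs : ∀ t ∈ Icc 0 T, x t ∈ φ.target) :
    IsC1 (n := n) T (fun t => S.point (φ.symm (x t)) (y t)) := by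
  have hbase : ContMDiffOn 𝓘(ℝ, ℝ) (𝓡 n) 1 (fun t => φ.symm (x t)) (Icc 0 T) :=
    ((contMDiffOn_symm_of_mem_maximalAtlas hφ).of_le (by simp)).comp
      (contMDiffOn_iff_contDiffOn.2 hx) hs
  exact (S.contMDiff_point.of_le (by simp)).comp_contMDiffOn
    (hbase.prodMk (contMDiffOn_iff_contDiffOn.2 hy))

theorem repr_accel_add_gradV (T : ℝ) (γ : ℝ → TotalSpace (EuclideanSpace ℝ (Fin m)) D) (t : ℝ)
    (C : Fin m) : (S.frame (γ t).proj).repr (S.accel T γ t + S.gradV (γ t).proj) C =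
      S.elimControl (γ t).proj (S.coord (γ t)) (S.ydot T γ t) C := by
  simp only [accel, map_add, Finsupp.add_apply, S.frame_repr_sum, elimControl]
  simp only [map_sum, map_smul, Finsupp.finsetSum_apply, Finsupp.smul_apply, smul_eq_mul,
    christoffel, mul_comm, mul_left_comm, mul_assoc]

theorem motion_iff {t : ℝ} {u : Fin m → ℝ} :
    S.accel T γ t + S.gradV (γ t).proj = ∑ A, u A • S.input A (γ t).proj ↔
      u = S.elimControl (γ t).proj (S.coord (γ t)) (S.ydot T γ t) := by
  rw [← (S.frame (γ t).proj).repr.injective.eq_iff, DFunLike.ext_iff, funext_iff]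
  simp only [S.repr_accel_add_gradV, S.frame_repr_sum]
  exact forall_congr' fun A => eq_comm

end Curves

section Lagrangian

variable {φ : OpenPartialHomeomorph Q (EuclideanSpace ℝ (Fin n))} {U : Set (Fin m → ℝ)}
  {C : TotalSpace (EuclideanSpace ℝ (Fin m)) D × (Fin m → ℝ) → ℝ}

/-- The point of `D` and the control whose coordinates are `(q, y, ẏ)`. -/
def stateControl (φ : OpenPartialHomeomorph Q (EuclideanSpace ℝ (Fin n)))
    (c : EuclideanSpace ℝ (Fin n) × (Fin m → ℝ) × (Fin m → ℝ)) :
    TotalSpace (EuclideanSpace ℝ (Fin m)) D × (Fin m → ℝ) :=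
  (S.point (φ.symm c.1) c.2.1, S.elimControl (φ.symm c.1) c.2.1 c.2.2)

theorem contMDiffOn_stateControl (hφ : φ ∈ IsManifold.maximalAtlas (𝓡 n) ∞ Q) :
    ContMDiffOn 𝓘(ℝ, EuclideanSpace ℝ (Fin n) × (Fin m → ℝ) × (Fin m → ℝ))
      (((𝓡 n).prod 𝓘(ℝ, EuclideanSpace ℝ (Fin m))).prod 𝓘(ℝ, Fin m → ℝ)) ∞
      (S.stateControl φ) {c | c.1 ∈ φ.target} :=
  (S.contMDiff_point.comp_contMDiffOn ((contMDiffOn_chart_symm_fst hφ).prodMk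
    (contMDiffOn_iff_contDiffOn.2 (contDiff_fst.comp contDiff_snd).contDiffOn))).prodMk
  (S.contMDiff_elimControl.comp_contMDiffOn
    ((contMDiffOn_chart_symm_fst hφ).prodMk (contMDiffOn_iff_contDiffOn.2 contDiffOn_snd)))

/-- The coordinates `(q, y, ẏ)` over the chart `φ` whose eliminated control lies in `U`: the domain
on which the Lagrangian `ℒ` is differentiable. -/
def controlDomain (φ : OpenPartialHomeomorph Q (EuclideanSpace ℝ (Fin n)))
    (U : Set (Fin m → ℝ)) : Set (EuclideanSpace ℝ (Fin n) × (Fin m → ℝ) × (Fin m → ℝ)) :=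
  {c | c.1 ∈ φ.target ∧ (S.stateControl φ c).2 ∈ U}

theorem isOpen_controlDomain (hφ : φ ∈ IsManifold.maximalAtlas (𝓡 n) ∞ Q) (hU : IsOpen U) :
    IsOpen (S.controlDomain φ U) :=
  (S.contMDiffOn_stateControl hφ).continuousOn.snd.isOpen_inter_preimage
    (φ.open_target.preimage continuous_fst) hU

/-- The Lagrangian `ℒ` as a function of the point `(q, y, ẏ)`, the form in which it enters a
variational problem. -/
def jetLagrangian (φ : OpenPartialHomeomorph Q (EuclideanSpace ℝ (Fin n)))
    (C : TotalSpace (EuclideanSpace ℝ (Fin m)) D × (Fin m → ℝ) → ℝ)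
    (c : EuclideanSpace ℝ (Fin n) × (Fin m → ℝ) × (Fin m → ℝ)) : ℝ :=
  S.lagrangian φ C c.1 c.2.1 c.2.2

theorem contDiffOn_jetLagrangian (hφ : φ ∈ IsManifold.maximalAtlas (𝓡 n) ∞ Q)
    (hC : ContMDiffOn (((𝓡 n).prod 𝓘(ℝ, EuclideanSpace ℝ (Fin m))).prod 𝓘(ℝ, Fin m → ℝ))
      𝓘(ℝ, ℝ) 1 C (univ ×ˢ U)) :
    ContDiffOn ℝ 1 (S.jetLagrangian φ C) (S.controlDomain φ U) :=
  contMDiffOn_iff_contDiffOn.1 <| hC.comp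
    (((S.contMDiffOn_stateControl hφ).mono fun c hc => hc.1).of_le (by simp))
    fun c hc => ⟨trivial, hc.2⟩

end Lagrangian

section PartialDerivatives

variable {φ : OpenPartialHomeomorph Q (EuclideanSpace ℝ (Fin n))}

theorem fderiv_velocityField_apply (hφ : φ ∈ IsManifold.maximalAtlas (𝓡 n) ∞ Q)
    {c : EuclideanSpace ℝ (Fin n) × (Fin m → ℝ) × (Fin m → ℝ)} (hc : c.1 ∈ φ.target)
    (δ : EuclideanSpace ℝ (Fin n) × (Fin m → ℝ) × (Fin m → ℝ)) (i : Fin n) :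
    fderiv ℝ (S.velocityField φ) c δ i = ∑ A, (S.anchorCoeff φ A i c.1 * δ.2.1 A
      + c.2.1 A * fderiv ℝ (S.anchorCoeff φ A i) c.1 δ.1) := by
  have hfield : DifferentiableAt ℝ (S.velocityField φ) c :=
    ((S.contDiffOn_velocityField hφ).differentiableOn (by simp)).differentiableAt
      ((φ.open_target.preimage continuous_fst).mem_nhds hc)
  have hcoeff (A : Fin m) : DifferentiableAt ℝ (S.anchorCoeff φ A i) c.1 :=
    ((S.contDiffOn_anchorCoeff hφ A i).differentiableOn (by simp)).differentiableAt
      (φ.open_target.mem_nhds hc)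
  have hcomp := (EuclideanSpace.proj (𝕜 := ℝ) i).hasFDerivAt.comp c hfield.hasFDerivAt
  have hsum := HasFDerivAt.fun_sum (u := Finset.univ) fun A _ =>
    ((hcoeff A).hasFDerivAt.comp c hasFDerivAt_fst).mul
      ((hasFDerivAt_apply A c.2.1).comp c (hasFDerivAt_fst.comp c hasFDerivAt_snd))
  simpa using DFunLike.congr_fun (hcomp.unique hsum) δ

theorem pairing_fderiv_velocityField_base (hφ : φ ∈ IsManifold.maximalAtlas (𝓡 n) ∞ Q)
    {c : EuclideanSpace ℝ (Fin n) × (Fin m → ℝ) × (Fin m → ℝ)} (hc : c.1 ∈ φ.target)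
    (l : Fin n → ℝ) (e : EuclideanSpace ℝ (Fin n)) :
    pairing n l (fderiv ℝ (S.velocityField φ) c (e, 0, 0))
      = ∑ j, ∑ A, l j * fderiv ℝ (S.anchorCoeff φ A j) c.1 e * c.2.1 A := by
  simp only [pairing_apply, S.fderiv_velocityField_apply hφ hc, Pi.zero_apply, mul_zero, zero_add,
    Finset.mul_sum]
  exact Finset.sum_congr rfl fun j _ => Finset.sum_congr rfl fun A _ => by ring

theorem pairing_fderiv_velocityField_fibre (hφ : φ ∈ IsManifold.maximalAtlas (𝓡 n) ∞ Q)
    {c : EuclideanSpace ℝ (Fin n) × (Fin m → ℝ) × (Fin m → ℝ)} (hc : c.1 ∈ φ.target)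
    (l : Fin n → ℝ) (A : Fin m) :
    pairing n l (fderiv ℝ (S.velocityField φ) c (0, Pi.single A 1, 0))
      = ∑ i, S.anchorCoeff φ A i c.1 * l i := by
  simp [pairing_apply, S.fderiv_velocityField_apply hφ hc, Pi.single_apply, mul_comm]

theorem fderiv_velocityField_velocity (hφ : φ ∈ IsManifold.maximalAtlas (𝓡 n) ∞ Q)
    {c : EuclideanSpace ℝ (Fin n) × (Fin m → ℝ) × (Fin m → ℝ)} (hc : c.1 ∈ φ.target)
    (e : Fin m → ℝ) : fderiv ℝ (S.velocityField φ) c (0, 0, e) = 0 := by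
  ext i
  simp [S.fderiv_velocityField_apply hφ hc]

variable {C : TotalSpace (EuclideanSpace ℝ (Fin m)) D × (Fin m → ℝ) → ℝ}
  {x : EuclideanSpace ℝ (Fin n)} {y v : Fin m → ℝ}

theorem fderiv_lagrangian_base (hL : DifferentiableAt ℝ (S.jetLagrangian φ C) (x, y, v))
    (e : EuclideanSpace ℝ (Fin n)) : fderiv ℝ (fun x => S.lagrangian φ C x y v) x e
      = fderiv ℝ (S.jetLagrangian φ C) (x, y, v) (e, 0, 0) := by
  have h := hL.hasFDerivAt.comp (f := fun x => (x, y, v)) x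
    (hasFDerivAt_prodMk_left x (y, v))
  exact DFunLike.congr_fun h.fderiv e

theorem fderiv_lagrangian_fibre (hL : DifferentiableAt ℝ (S.jetLagrangian φ C) (x, y, v))
    (e : Fin m → ℝ) : fderiv ℝ (fun y => S.lagrangian φ C x y v) y e
      = fderiv ℝ (S.jetLagrangian φ C) (x, y, v) (0, e, 0) := by
  have h := hL.hasFDerivAt.comp (f := fun y => (x, y, v)) y
    (HasFDerivAt.comp y (hasFDerivAt_prodMk_right x (y, v)) (hasFDerivAt_prodMk_left y v))
  exact DFunLike.congr_fun h.fderiv e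

theorem fderiv_lagrangian_velocity (hL : DifferentiableAt ℝ (S.jetLagrangian φ C) (x, y, v))
    (e : Fin m → ℝ) : fderiv ℝ (fun v => S.lagrangian φ C x y v) v e
      = fderiv ℝ (S.jetLagrangian φ C) (x, y, v) (0, 0, e) := by
  have h := hL.hasFDerivAt.comp v
    ((hasFDerivAt_prodMk_right x (y, v)).comp v (hasFDerivAt_prodMk_right y v))
  exact DFunLike.congr_fun h.fderiv e

end PartialDerivatives

section ControlledCurve

variable {φ : OpenPartialHomeomorph Q (EuclideanSpace ℝ (Fin n))}
  {U : Set (Fin m → ℝ)} {C : TotalSpace (EuclideanSpace ℝ (Fin m)) D × (Fin m → ℝ) → ℝ}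
  {T : ℝ} {γ : ℝ → TotalSpace (EuclideanSpace ℝ (Fin m)) D}

/-- The coordinates `(q, y, ẏ)` of a curve `γ` in `D`. -/
def jetPath (φ : OpenPartialHomeomorph Q (EuclideanSpace ℝ (Fin n))) (T : ℝ)
    (γ : ℝ → TotalSpace (EuclideanSpace ℝ (Fin m)) D) (t : ℝ) :
    EuclideanSpace ℝ (Fin n) × (Fin m → ℝ) × (Fin m → ℝ) :=
  (basePath φ γ t, S.coord (γ t), S.ydot T γ t)

/-- A `C¹` curve over the domain of the chart `φ` whose eliminated control takes values in `U`. -/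
structure IsControlledCurve (φ : OpenPartialHomeomorph Q (EuclideanSpace ℝ (Fin n)))
    (U : Set (Fin m → ℝ)) (T : ℝ) (γ : ℝ → TotalSpace (EuclideanSpace ℝ (Fin m)) D) : Prop where
  isC1 : IsC1 (n := n) T γ
  source : ∀ t ∈ Icc 0 T, (γ t).proj ∈ φ.source
  control : ∀ t ∈ Icc 0 T, S.elimControl (γ t).proj (S.coord (γ t)) (S.ydot T γ t) ∈ U

theorem extAction_add_smul {x : ℝ → EuclideanSpace ℝ (Fin n)} {y : ℝ → Fin m → ℝ} (hT : 0 < T)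
    (hx : DifferentiableOn ℝ x (Icc 0 T)) (hy : DifferentiableOn ℝ y (Icc 0 T))
    {δz : ℝ → EuclideanSpace ℝ (Fin n) × (Fin m → ℝ)} (hδz : Differentiable ℝ δz)
    (lam δlam : ℝ → Fin n → ℝ) (μ ε : ℝ) :
    S.extAction φ C μ T (fun t => x t + ε • (δz t).1) (fun t => y t + ε • (δz t).2)
        (fun t => lam t + ε • δlam t)
      = ∫ t in (0 : ℝ)..T,
          augmentedLagrangian μ (S.jetLagrangian φ C) (S.velocityField φ) (pairing n)
            ((x t, y t) + ε • δz t,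
              (derivWithin x (Icc 0 T) t, derivWithin y (Icc 0 T) t) + ε • deriv δz t,
              lam t + ε • δlam t) := by
  refine intervalIntegral.integral_congr fun t ht => ?_
  rw [uIcc_of_le hT.le] at ht
  have hfst : HasDerivAt (fun t => (δz t).1) (deriv δz t).1 t :=
    (hδz t).hasFDerivAt.fst.hasDerivAt
  have hsnd : HasDerivAt (fun t => (δz t).2) (deriv δz t).2 t :=
    (hδz t).hasFDerivAt.snd.hasDerivAt
  have hbase : derivWithin (fun t => x t + ε • (δz t).1) (Icc 0 T) t
      = derivWithin x (Icc 0 T) t + ε • (deriv δz t).1 :=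
    ((hx t ht).hasDerivWithinAt.add (hfst.hasDerivWithinAt.const_smul ε)).derivWithin
      (uniqueDiffOn_Icc hT t ht)
  have hfibre : derivWithin (fun t => y t + ε • (δz t).2) (Icc 0 T) t
      = derivWithin y (Icc 0 T) t + ε • (deriv δz t).2 :=
    ((hy t ht).hasDerivWithinAt.add (hsnd.hasDerivWithinAt.const_smul ε)).derivWithin
      (uniqueDiffOn_Icc hT t ht)
  simp only [extLagrangian, hbase, hfibre, augmentedLagrangian, ContinuousLinearEquiv.coe_coe,
    pairing_apply]
  rfl

namespace IsControlledCurve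

variable {S}

theorem jetPath_mem (hγ : S.IsControlledCurve φ U T γ) {t : ℝ} (ht : t ∈ Icc 0 T) :
    S.jetPath φ T γ t ∈ S.controlDomain φ U := by
  refine ⟨φ.map_source (hγ.source t ht), ?_⟩
  simp only [stateControl, jetPath, basePath, φ.left_inv (hγ.source t ht)]
  exact hγ.control t ht

theorem contDiffOn_basePath (hγ : S.IsControlledCurve φ U T γ)
    (hφ : φ ∈ IsManifold.maximalAtlas (𝓡 n) ∞ Q) : ContDiffOn ℝ 1 (basePath φ γ) (Icc 0 T) := by
  have : IsManifold (𝓡 n) 1 Q := .of_le (n := ∞) (by simp)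
  exact contDiffOn_chart_comp (IsManifold.maximalAtlas_subset_of_le (by simp) hφ)
    ((contMDiff_proj D).comp_contMDiffOn hγ.isC1) hγ.source

theorem hasDerivWithinAt_coord (hγ : S.IsControlledCurve φ U T γ) {t : ℝ} (ht : t ∈ Icc 0 T) :
    HasDerivWithinAt (fun s => S.coord (γ s)) (S.ydot T γ t) (Icc 0 T) t :=
  ((S.contDiffOn_coord hγ.isC1).differentiableOn one_ne_zero t ht).hasDerivWithinAt

theorem continuousOn_ydot (hγ : S.IsControlledCurve φ U T γ) (hT : 0 < T) :
    ContinuousOn (S.ydot T γ) (Icc 0 T) :=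
  ((contDiffOn_one_iff_derivWithin (uniqueDiffOn_Icc hT)).1 (S.contDiffOn_coord hγ.isC1)).2

theorem isExtremal_iff_isStationary (hγ : S.IsControlledCurve φ U T γ) (hT : 0 < T)
    (hφ : φ ∈ IsManifold.maximalAtlas (𝓡 n) ∞ Q) (μ : ℝ) (lam : ℝ → Fin n → ℝ) :
    S.IsExtremal φ C μ T γ lam ↔ ContinuousOn lam (Icc 0 T) ∧
      IsStationary 0 T
        (augmentedLagrangian μ (S.jetLagrangian φ C) (S.velocityField φ) (pairing n))
        (fun t => (basePath φ γ t, S.coord (γ t)))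
        (fun t => (derivWithin (basePath φ γ) (Icc 0 T) t, S.ydot T γ t)) lam := by
  have haction {δz : ℝ → EuclideanSpace ℝ (Fin n) × (Fin m → ℝ)} (hδz : ContDiff ℝ 1 δz)
      (δlam : ℝ → Fin n → ℝ) := S.extAction_add_smul (φ := φ) (C := C) hT
    ((hγ.contDiffOn_basePath hφ).differentiableOn one_ne_zero)
    ((S.contDiffOn_coord hγ.isC1).differentiableOn one_ne_zero)
    (hδz.differentiable one_ne_zero) lam δlam μ
  refine and_congr_right fun _ => ⟨fun h δz δlam hδz hδlam h0 hT0 => ?_,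
    fun h δx δy δlam hδx hδy hδlam hx0 hxT hy0 hyT => ?_⟩
  · refine HasDerivAt.congr_of_eventuallyEq ?_ (.of_forall fun ε => (haction hδz δlam ε).symm)
    exact h (fun t => (δz t).1) (fun t => (δz t).2) δlam hδz.fst hδz.snd hδlam (by simp [h0])
      (by simp [hT0]) (by simp [h0]) (by simp [hT0])
  · refine HasDerivAt.congr_of_eventuallyEq ?_ (.of_forall (haction (hδx.prodMk hδy) δlam))
    exact h (fun t => (δx t, δy t)) δlam (hδx.prodMk hδy) hδlam (by simp [hx0, hy0])
      (by simp [hxT, hyT])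

theorem isAdmissible_iff_derivWithin_eq (hγ : S.IsControlledCurve φ U T γ) (hT : 0 < T)
    (hφ : φ ∈ IsManifold.maximalAtlas (𝓡 n) ∞ Q) :
    S.IsAdmissible T γ ↔ ∀ t ∈ Icc 0 T,
      derivWithin (basePath φ γ) (Icc 0 T) t = S.velocityField φ (S.jetPath φ T γ t) := by
  rw [S.isAdmissible_iff hφ (S.ydot T γ) hγ.source]
  refine forall₂_congr fun t ht => ⟨fun h => h.derivWithin (uniqueDiffOn_Icc hT t ht), fun h => ?_⟩
  exact ((hγ.contDiffOn_basePath hφ).differentiableOn one_ne_zero t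
    ht).hasDerivWithinAt.congr_deriv h

theorem isAdmissible_iff_components (hγ : S.IsControlledCurve φ U T γ)
    (hφ : φ ∈ IsManifold.maximalAtlas (𝓡 n) ∞ Q) :
    S.IsAdmissible T γ ↔ ∀ t ∈ Icc 0 T, ∀ i : Fin n,
      HasDerivWithinAt (fun s => basePath φ γ s i)
        (∑ A, S.anchorCoeff φ A i (basePath φ γ t) * S.coord (γ t) A) (Icc 0 T) t := by
  rw [S.isAdmissible_iff hφ (S.ydot T γ) hγ.source]
  refine forall₂_congr fun t _ => ?_
  simp only [hasDerivWithinAt_iff_hasFDerivWithinAt, hasFDerivWithinAt_euclidean]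
  refine forall_congr' fun i => iff_of_eq (congrArg (HasFDerivWithinAt _ · _ _) ?_)
  ext
  simp [velocityField]

variable (hγ : S.IsControlledCurve φ U T γ) (hT : 0 < T)
  (hφ : φ ∈ IsManifold.maximalAtlas (𝓡 n) ∞ Q) (hU : IsOpen U)
  (hC : ContMDiffOn (((𝓡 n).prod 𝓘(ℝ, EuclideanSpace ℝ (Fin m))).prod 𝓘(ℝ, Fin m → ℝ))
    𝓘(ℝ, ℝ) 1 C (univ ×ˢ U))
include hγ hφ hU hC

theorem differentiableAt_jetLagrangian {t : ℝ} (ht : t ∈ Icc 0 T) :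
    DifferentiableAt ℝ (S.jetLagrangian φ C) (S.jetPath φ T γ t) :=
  ((S.contDiffOn_jetLagrangian hφ hC).differentiableOn one_ne_zero).differentiableAt
    ((S.isOpen_controlDomain hφ hU).mem_nhds (hγ.jetPath_mem ht))

theorem necessaryConditions_iff (lam : ℝ → Fin n → ℝ) :
    S.NecessaryConditions φ C T γ lam ↔
      ((∀ t ∈ Icc 0 T, ∀ i : Fin n, HasDerivWithinAt (fun s => lam s i)
          (fderiv ℝ (S.jetLagrangian φ C) (S.jetPath φ T γ t) (EuclideanSpace.single i 1, 0, 0)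
            - pairing n (lam t) (fderiv ℝ (S.velocityField φ) (S.jetPath φ T γ t)
              (EuclideanSpace.single i 1, 0, 0))) (Icc 0 T) t) ∧
        ∀ t ∈ Icc 0 T, ∀ A : Fin m, HasDerivWithinAt
          (fun s => fderiv ℝ (S.jetLagrangian φ C) (S.jetPath φ T γ s) (0, 0, Pi.single A 1)
            - pairing n (lam s) (fderiv ℝ (S.velocityField φ) (S.jetPath φ T γ s)
              (0, 0, Pi.single A 1)))
          (fderiv ℝ (S.jetLagrangian φ C) (S.jetPath φ T γ t) (0, Pi.single A 1, 0)
            - pairing n (lam t) (fderiv ℝ (S.velocityField φ) (S.jetPath φ T γ t)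
              (0, Pi.single A 1, 0))) (Icc 0 T) t) ∧
      S.IsAdmissible T γ := by
  have hL (t : ℝ) (ht : t ∈ Icc 0 T) := hγ.differentiableAt_jetLagrangian hφ hU hC ht
  have hbase (t : ℝ) (ht : t ∈ Icc 0 T) : (S.jetPath φ T γ t).1 ∈ φ.target :=
    φ.map_source (hγ.source t ht)
  have hmomentum (A : Fin m) (t : ℝ) (ht : t ∈ Icc 0 T) :
      fderiv ℝ (fun v => S.lagrangian φ C (basePath φ γ t) (S.coord (γ t)) v) (S.ydot T γ t)
          (Pi.single A 1)
        = fderiv ℝ (S.jetLagrangian φ C) (S.jetPath φ T γ t) (0, 0, Pi.single A 1)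
          - pairing n (lam t) (fderiv ℝ (S.velocityField φ) (S.jetPath φ T γ t)
            (0, 0, Pi.single A 1)) := by
    rw [S.fderiv_velocityField_velocity hφ (hbase t ht), map_zero, sub_zero]
    exact S.fderiv_lagrangian_velocity (hL t ht) _
  have hforce (A : Fin m) (t : ℝ) (ht : t ∈ Icc 0 T) :=
    congrArg₂ (· - ·) (S.fderiv_lagrangian_fibre (hL t ht) (Pi.single A 1))
      (S.pairing_fderiv_velocityField_fibre hφ (hbase t ht) (lam t) A).symm
  have hrate (t : ℝ) (ht : t ∈ Icc 0 T) (i : Fin n) :=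
    congrArg₂ (· - ·) (S.fderiv_lagrangian_base (hL t ht) (EuclideanSpace.single i 1))
      (S.pairing_fderiv_velocityField_base hφ (hbase t ht) (lam t)
        (EuclideanSpace.single i 1)).symm
  rw [hγ.isAdmissible_iff_components hφ]
  constructor
  · rintro ⟨hrates, hforces, hadm⟩
    exact ⟨⟨fun t ht i => (hrates t ht i).congr_deriv (hrate t ht i),
      fun t ht A => ((hforces t ht A).congr (fun s hs => (hmomentum A s hs).symm)
        (hmomentum A t ht).symm).congr_deriv (hforce A t ht)⟩, hadm⟩
  · rintro ⟨⟨hrates, hforces⟩, hadm⟩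
    exact ⟨fun t ht i => (hrates t ht i).congr_deriv (hrate t ht i).symm,
      fun t ht A => ((hforces t ht A).congr (hmomentum A) (hmomentum A t ht)).congr_deriv
        (hforce A t ht).symm, hadm⟩

include hT

theorem isStationary_iff {lam : ℝ → Fin n → ℝ} (hlam : ContinuousOn lam (Icc 0 T)) :
    IsStationary 0 T
        (augmentedLagrangian 1 (S.jetLagrangian φ C) (S.velocityField φ) (pairing n))
        (fun t => (basePath φ γ t, S.coord (γ t)))
        (fun t => (derivWithin (basePath φ γ) (Icc 0 T) t, S.ydot T γ t)) lam ↔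
      S.NecessaryConditions φ C T γ lam := by
  have hx := hγ.contDiffOn_basePath hφ
  have hR : ContDiffOn ℝ 1 (S.velocityField φ) (S.controlDomain φ U) :=
    ((S.contDiffOn_velocityField hφ).of_le (by simp)).mono fun c hc => hc.1
  rw [isStationary_augmentedLagrangian_iff (EuclideanSpace.basisFun (Fin n) ℝ).toBasis
    (Pi.basisFun ℝ (Fin m)) hT (S.isOpen_controlDomain hφ hU) (S.contDiffOn_jetLagrangian hφ hC) hR
    eq_zero_of_forall_pairing_eq_zero hx.continuousOn (S.contDiffOn_coord hγ.isC1).continuousOn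
    ((contDiffOn_one_iff_derivWithin (uniqueDiffOn_Icc hT)).1 hx).2 (hγ.continuousOn_ydot hT) hlam
    fun t ht => hγ.jetPath_mem ht, hγ.necessaryConditions_iff hφ hU hC lam,
    hγ.isAdmissible_iff_derivWithin_eq hT hφ]
  simp only [OrthonormalBasis.coe_toBasis, EuclideanSpace.basisFun_apply, Pi.basisFun_apply,
    pairing_single, ContinuousLinearEquiv.coe_coe, one_mul, jetPath]

theorem isNormalExtremal_iff (lam : ℝ → Fin n → ℝ) :
    S.IsNormalExtremal φ C T γ lam ↔ S.IsAdmissible T γ ∧ S.NecessaryConditions φ C T γ lam := by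
  rw [IsNormalExtremal, hγ.isExtremal_iff_isStationary hT hφ]
  constructor
  · rintro ⟨hlam, hstat⟩
    have hnec := (hγ.isStationary_iff hT hφ hU hC hlam).1 hstat
    exact ⟨(hγ.isAdmissible_iff_components hφ).2 hnec.admissible_eq, hnec⟩
  · rintro ⟨-, hnec⟩
    have hlam : ContinuousOn lam (Icc 0 T) := continuousOn_pi.2 fun i t ht =>
      (hnec.multiplier_eq t ht i).continuousWithinAt
    exact ⟨hlam, (hγ.isStationary_iff hT hφ hU hC hlam).2 hnec⟩

end IsControlledCurve

end ControlledCurve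

section Optimality

variable {φ : OpenPartialHomeomorph Q (EuclideanSpace ℝ (Fin n))}
  {U : Set (Fin m → ℝ)} {C : TotalSpace (EuclideanSpace ℝ (Fin m)) D × (Fin m → ℝ) → ℝ}
  {T : ℝ} {γ : ℝ → TotalSpace (EuclideanSpace ℝ (Fin m)) D} {u : ℝ → Fin m → ℝ}
  {x : ℝ → EuclideanSpace ℝ (Fin n)} {y v : ℝ → Fin m → ℝ}

/-- Full actuation leaves `ẏ` free: the control is whatever the equation of motion requires. -/
theorem isSolution_stateControl (hT : 0 < T) (hφ : φ ∈ IsManifold.maximalAtlas (𝓡 n) ∞ Q)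
    (h : IsTrajectory 0 T (S.velocityField φ) x y v)
    (hdom : ∀ t ∈ Icc 0 T, (x t, y t, v t) ∈ S.controlDomain φ U) :
    S.IsSolution U T (fun t => (S.stateControl φ (x t, y t, v t)).1)
      (fun t => (S.stateControl φ (x t, y t, v t)).2) := by
  have htarget (t : ℝ) (ht : t ∈ Icc 0 T) : x t ∈ φ.target := (hdom t ht).1
  have hvel : ContinuousOn (fun t => S.velocityField φ (x t, y t, v t)) (Icc 0 T) :=
    (S.contDiffOn_velocityField hφ).continuousOn.comp h.continuousOn htarget
  refine ⟨S.isC1_point hφ (contDiffOn_one_of_hasDerivWithinAt_Icc hT h.base hvel)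
    (contDiffOn_one_of_hasDerivWithinAt_Icc hT h.fibre h.continuousOn_velocity) htarget, ?_,
    fun t ht => (hdom t ht).2, fun t ht => ?_⟩
  · rw [S.isAdmissible_iff hφ v fun t ht => φ.map_target (htarget t ht)]
    intro t ht
    have hbase : EqOn (basePath φ fun t => (S.stateControl φ (x t, y t, v t)).1) x (Icc 0 T) :=
      fun s hs => φ.right_inv (htarget s hs)
    rw [hbase ht, stateControl, S.coord_point]
    exact (h.base t ht).congr hbase (hbase ht)
  · have hydot : S.ydot T (fun t => (S.stateControl φ (x t, y t, v t)).1) t = v t := by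
      simp only [ydot, stateControl, S.coord_point]
      exact (h.fibre t ht).derivWithin (uniqueDiffOn_Icc hT t ht)
    rw [S.motion_iff, hydot, stateControl, S.coord_point]
    rfl

variable {S}

theorem IsSolution.control_eq (h : S.IsSolution U T γ u) {t : ℝ} (ht : t ∈ Icc 0 T) :
    u t = S.elimControl (γ t).proj (S.coord (γ t)) (S.ydot T γ t) :=
  S.motion_iff.1 (h.motion t ht)

theorem IsSolution.isControlledCurve (h : S.IsSolution U T γ u)
    (hs : ∀ t ∈ Icc 0 T, (γ t).proj ∈ φ.source) : S.IsControlledCurve φ U T γ :=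
  ⟨h.isC1, hs, fun t ht => h.control_eq ht ▸ h.control_mem t ht⟩

theorem IsSolution.stateControl_jetPath (h : S.IsSolution U T γ u) {t : ℝ} (ht : t ∈ Icc 0 T)
    (hs : (γ t).proj ∈ φ.source) : S.stateControl φ (S.jetPath φ T γ t) = (γ t, u t) := by
  rw [stateControl, jetPath, basePath, φ.left_inv hs, S.point_coord, h.control_eq ht]

theorem IsSolution.isTrajectory (h : S.IsSolution U T γ u) (hT : 0 < T)
    (hφ : φ ∈ IsManifold.maximalAtlas (𝓡 n) ∞ Q) (hs : ∀ t ∈ Icc 0 T, (γ t).proj ∈ φ.source) :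
    IsTrajectory 0 T (S.velocityField φ) (basePath φ γ) (fun t => S.coord (γ t)) (S.ydot T γ) where
  continuousOn_velocity := (h.isControlledCurve hs).continuousOn_ydot hT
  base := (S.isAdmissible_iff hφ (S.ydot T γ) hs).1 h.admissible
  fibre _ ht := (h.isControlledCurve hs).hasDerivWithinAt_coord ht

namespace IsOptimal

variable (h : S.IsOptimal U C T γ u) (hT : 0 < T) (hφ : φ ∈ IsManifold.maximalAtlas (𝓡 n) ∞ Q)
  (hU : IsOpen U) (hs : ∀ t ∈ Icc 0 T, (γ t).proj ∈ φ.source)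
include h hT hφ hU hs

theorem isWeakLocalMin :
    IsWeakLocalMin 0 T (S.jetLagrangian φ C) (S.velocityField φ) (basePath φ γ)
      (fun t => S.coord (γ t)) (S.ydot T γ) := by
  obtain ⟨hsol, W, hW, hgraph, hmin⟩ := h
  have htraj := hsol.isTrajectory hT hφ hs
  have heq (t : ℝ) (ht : t ∈ Icc 0 T) := hsol.stateControl_jetPath ht (hs t ht)
  let N : Set (ℝ × EuclideanSpace ℝ (Fin n) × (Fin m → ℝ) × (Fin m → ℝ)) :=
    Prod.snd ⁻¹' S.controlDomain φ U ∩ (fun c => (c.1, S.stateControl φ c.2)) ⁻¹' W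
  have hN : IsOpen N :=
    (continuousOn_fst.prodMk ((S.contMDiffOn_stateControl hφ).continuousOn.comp continuousOn_snd
      fun c hc => hc.1)).isOpen_inter_preimage
        ((S.isOpen_controlDomain hφ hU).preimage continuous_snd) hW
  have hcompact : IsCompact ((fun t => (t, S.jetPath φ T γ t)) '' Icc 0 T) :=
    isCompact_Icc.image_of_continuousOn (continuousOn_id.prodMk htraj.continuousOn)
  obtain ⟨δ, hδ, hthick⟩ := hcompact.exists_thickening_subset_open hN <| image_subset_iff.2
    fun t ht => ⟨(hsol.isControlledCurve hs).jetPath_mem ht, by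
      simpa only [mem_preimage, heq t ht] using hgraph t ht⟩
  refine ⟨htraj, δ, hδ, fun x y v h hx0 hy0 hxT hyT hclose => ?_⟩
  have hmem (t : ℝ) (ht : t ∈ Icc 0 T) : (t, x t, y t, v t) ∈ N :=
    hthick <| Metric.mem_thickening_iff.2 ⟨_, mem_image_of_mem _ ht, by
      rw [Prod.dist_eq, dist_self]; exact max_lt hδ (hclose t ht)⟩
  have hend {t : ℝ} (ht : t ∈ Icc 0 T) (hx : x t = basePath φ γ t) (hy : y t = S.coord (γ t)) :
      (S.stateControl φ (x t, y t, v t)).1 = γ t := by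
    simpa only [stateControl, jetPath, hx, hy] using congrArg Prod.fst (heq t ht)
  refine le_of_eq_of_le (intervalIntegral.integral_congr fun t ht => ?_)
    (hmin _ _ (S.isSolution_stateControl hT hφ h fun t ht => (hmem t ht).1)
      (hend (left_mem_Icc.2 hT.le) hx0 hy0) (hend (right_mem_Icc.2 hT.le) hxT hyT)
      fun t ht => (hmem t ht).2)
  exact congrArg C (heq t (uIcc_of_le hT.le ▸ ht))

theorem exists_extremal
    (hC : ContMDiffOn (((𝓡 n).prod 𝓘(ℝ, EuclideanSpace ℝ (Fin m))).prod 𝓘(ℝ, Fin m → ℝ))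
      𝓘(ℝ, ℝ) 1 C (univ ×ˢ U)) :
    (∃ lam, S.IsNormalExtremal φ C T γ lam) ∨ ∃ lam, S.IsAbnormalExtremal φ C T γ lam := by
  have hγ := h.1.isControlledCurve hs
  obtain ⟨μ, lam, hμ, hlam, hstat⟩ := (h.isWeakLocalMin hT hφ hU hs).exists_isStationary hT
    (S.isOpen_controlDomain hφ hU) (S.contDiffOn_jetLagrangian hφ hC)
    (((S.contDiffOn_velocityField hφ).of_le (by simp)).mono fun c hc => hc.1)
    (fun t ht => hγ.jetPath_mem ht) (pairing n)
  have hvel := (hγ.isAdmissible_iff_derivWithin_eq hT hφ).1 h.1.admissible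
  have hext : S.IsExtremal φ C μ T γ lam := (hγ.isExtremal_iff_isStationary hT hφ μ lam).2
    ⟨hlam, hstat.congr_velocity hT.le fun t ht => Prod.ext (hvel t ht) rfl⟩
  obtain rfl | ⟨rfl, hne⟩ := hμ
  · exact .inl ⟨lam, hext⟩
  · exact .inr ⟨lam, hext, hne⟩

end IsOptimal

end Optimality

end System

end

end NonholonomicControl

theorem mainTheorem1_general {n m : ℕ} {Q : Type*} [TopologicalSpace Q]
    [ChartedSpace (EuclideanSpace ℝ (Fin n)) Q] [IsManifold (𝓡 n) ∞ Q]
    {D : Q → Type*} [TopologicalSpace (TotalSpace (EuclideanSpace ℝ (Fin m)) D)]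
    [∀ x, AddCommGroup (D x)] [∀ x, Module ℝ (D x)] [∀ x, TopologicalSpace (D x)]
    [FiberBundle (EuclideanSpace ℝ (Fin m)) D] [VectorBundle ℝ (EuclideanSpace ℝ (Fin m)) D]
    [ContMDiffVectorBundle ∞ (EuclideanSpace ℝ (Fin m)) D (𝓡 n)]
    (S : NonholonomicControl.System n m Q D)
    (U : Set (Fin m → ℝ)) (hU : IsOpen U)
    (C : TotalSpace (EuclideanSpace ℝ (Fin m)) D × (Fin m → ℝ) → ℝ)
    (hC : ContMDiffOn (((𝓡 n).prod 𝓘(ℝ, EuclideanSpace ℝ (Fin m))).prod 𝓘(ℝ, Fin m → ℝ))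
      𝓘(ℝ, ℝ) 1 C (univ ×ˢ U))
    (T : ℝ) (hT : 0 < T)
    (φ : OpenPartialHomeomorph Q (EuclideanSpace ℝ (Fin n)))
    (hφ : φ ∈ IsManifold.maximalAtlas (𝓡 n) ∞ Q) :
    (∀ γ : ℝ → TotalSpace (EuclideanSpace ℝ (Fin m)) D,
      NonholonomicControl.System.IsC1 (n := n) T γ →
      (∀ t ∈ Icc 0 T, (γ t).proj ∈ φ.source) →
      (∀ t ∈ Icc 0 T, S.elimControl (γ t).proj (S.coord (γ t)) (S.ydot T γ t) ∈ U) →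
      ∀ lam : ℝ → Fin n → ℝ,
        S.IsNormalExtremal φ C T γ lam ↔
          S.IsAdmissible T γ ∧ S.NecessaryConditions φ C T γ lam) ∧
    (∀ (γ : ℝ → TotalSpace (EuclideanSpace ℝ (Fin m)) D) (u : ℝ → Fin m → ℝ),
      S.IsOptimal U C T γ u →
      (∀ t ∈ Icc 0 T, (γ t).proj ∈ φ.source) →
      ((∃ lam, S.IsNormalExtremal φ C T γ lam) ∨ (∃ lam, S.IsAbnormalExtremal φ C T γ lam)) ∧
      ((¬ ∃ lam, S.IsAbnormalExtremal φ C T γ lam) →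
        ∃ lam, S.NecessaryConditions φ C T γ lam)) := by
  refine ⟨fun γ hC1 hs hu => ?_, fun γ u h hs => ?_⟩
  · have hγ : S.IsControlledCurve φ U T γ := ⟨hC1, hs, hu⟩
    exact hγ.isNormalExtremal_iff hT hφ hU hC
  · have hex := h.exists_extremal hT hφ hU hs hC
    refine ⟨hex, fun hab => ?_⟩
    obtain ⟨lam, hlam⟩ := hex.resolve_right hab
    have hγ := h.1.isControlledCurve hs
    exact ⟨lam, ((hγ.isNormalExtremal_iff hT hφ hU hC lam).1 hlam).2⟩

theorem mainTheorem1 {n m : ℕ} {Q : Type*} [TopologicalSpace Q] [T2Space Q] [SecondCountableTopology Q]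
    [ChartedSpace (EuclideanSpace ℝ (Fin n)) Q] [IsManifold (𝓡 n) ∞ Q]
    {D : Q → Type*} [TopologicalSpace (TotalSpace (EuclideanSpace ℝ (Fin m)) D)]
    [∀ x, AddCommGroup (D x)] [∀ x, Module ℝ (D x)] [∀ x, TopologicalSpace (D x)]
    [FiberBundle (EuclideanSpace ℝ (Fin m)) D] [VectorBundle ℝ (EuclideanSpace ℝ (Fin m)) D]
    [ContMDiffVectorBundle ∞ (EuclideanSpace ℝ (Fin m)) D (𝓡 n)]
    (S : NonholonomicControl.System n m Q D)
    (U : Set (Fin m → ℝ)) (hU : IsOpen U)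
    (C : TotalSpace (EuclideanSpace ℝ (Fin m)) D × (Fin m → ℝ) → ℝ)
    (hC : ContMDiffOn (((𝓡 n).prod 𝓘(ℝ, EuclideanSpace ℝ (Fin m))).prod 𝓘(ℝ, Fin m → ℝ))
      𝓘(ℝ, ℝ) ∞ C (univ ×ˢ U))
    (T : ℝ) (hT : 0 < T)
    (φ : OpenPartialHomeomorph Q (EuclideanSpace ℝ (Fin n)))
    (hφ : φ ∈ IsManifold.maximalAtlas (𝓡 n) ∞ Q) :
    -- normal extremals are exactly the admissible curves that satisfy the necessary conditions
    (∀ γ : ℝ → TotalSpace (EuclideanSpace ℝ (Fin m)) D,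
      NonholonomicControl.System.IsC1 (n := n) T γ →
      (∀ t ∈ Icc 0 T, (γ t).proj ∈ φ.source) →
      (∀ t ∈ Icc 0 T, S.elimControl (γ t).proj (S.coord (γ t)) (S.ydot T γ t) ∈ U) →
      ∀ lam : ℝ → Fin n → ℝ,
        S.IsNormalExtremal φ C T γ lam ↔
          S.IsAdmissible T γ ∧ S.NecessaryConditions φ C T γ lam) ∧
    -- solutions of the optimal control problem are extremals, normal or abnormal; those which are
    -- not abnormal satisfy the necessary conditions
    (∀ (γ : ℝ → TotalSpace (EuclideanSpace ℝ (Fin m)) D) (u : ℝ → Fin m → ℝ),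
      S.IsOptimal U C T γ u →
      (∀ t ∈ Icc 0 T, (γ t).proj ∈ φ.source) →
      ((∃ lam, S.IsNormalExtremal φ C T γ lam) ∨ (∃ lam, S.IsAbnormalExtremal φ C T γ lam)) ∧
      ((¬ ∃ lam, S.IsAbnormalExtremal φ C T γ lam) →
        ∃ lam, S.NecessaryConditions φ C T γ lam)) := by
  exact mainTheorem1_general S U hU C (hC.of_le (by simp)) T hT φ hφ
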